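/- A planar map is a proper embedding of a finite connected graph (loops and multiple edges allowed) in the oriented sphere, considered up to orientation-preserving homeomorphism. It is rooted by orienting one of its edges; by convention, the atomic map, which has one vertex, one face and no edge, is also counted as a rooted planar map. A tree-rooted planar map is a rooted planar map equipped with a distinguished spanning tree. A power series $F\in\mathbb{Q}[[x_1,\dots,x_k]]$ is D-finite if, for each $i\le k$, it satisfies a non-trivial linear differential equation in $x_i$ with coefficients in $\mathbb{Q}[x_1,\dots,x_k]$. Proposition. For every $n\ge 0$, the number $T_n$ of tree-rooted planar maps with $n$ edges is $$T_n=\frac{(2n)!\,(2n+2)!}{n!\,(n+1)!^2\,(n+2)!}.$$ For all $i,j\ge 0$, the number $T_{i,j}$ of tree-rooted planar maps with $i+1$ vertices and $j+1$ faces is $$T_{i,j}=\frac{(2i+2j)!}{i!\,(i+1)!\,j!\,(j+1)!}.$$ The generating functions $\sum_{n\ge 0}T_n t^n$ and $\sum_{i,j\ge 0}T_{i,j}w^iz^j$ are D-finite. -/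

import Mathlib

/-- A map without isolated vertices on an oriented closed surface (connected or not), presented
by its rotation system: `D` is the set of darts (edges with a choice of orientation), `opp` reverses the
orientation of a dart, and `next` sends a dart to the next one in counterclockwise order around
the same origin. Loops and multiple edges are allowed. -/
structure RotationSystem (D : Type) where
  next : Equiv.Perm D
  opp : Equiv.Perm D
  opp_opp : ∀ d, opp (opp d) = d
  opp_ne : ∀ d, opp d ≠ d

namespace RotationSystem

variable {D : Type} (M : RotationSystem D)

/-- Vertices: the cycles of `next` (a vertex is the cyclic sequence of darts leaving it). -/
def Vertex : Type := Quotient (Equiv.Perm.SameCycle.setoid M.next)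

/-- Edges: the cycles of `opp`, that is, pairs of opposite darts. -/
def Edge : Type := Quotient (Equiv.Perm.SameCycle.setoid M.opp)

/-- Faces: the cycles of the permutation `d ↦ next (opp d)`, which walks along the dart `d` and
then takes the next dart on the boundary of the face lying to the right of `d`. -/
def Face : Type := Quotient (Equiv.Perm.SameCycle.setoid (M.next * M.opp))

/-- The origin of a dart. -/
def origin (d : D) : M.Vertex := Quotient.mk (Equiv.Perm.SameCycle.setoid M.next) d

/-- The edge underlying a dart. -/
def edge (d : D) : M.Edge := Quotient.mk (Equiv.Perm.SameCycle.setoid M.opp) d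

/-- The underlying graph is connected. -/
def IsConnected : Prop :=
  ∀ d d' : D, ∃ g ∈ Subgroup.closure {M.next, M.opp}, g d = d'

/-- The map is drawn on the sphere: it is connected and its Euler characteristic is `2`. -/
def IsPlanar : Prop :=
  M.IsConnected ∧ Nat.card M.Vertex + Nat.card M.Face = Nat.card M.Edge + 2

/-- The simple graph on the vertices of the map in which two distinct vertices are adjacent when
they are joined by an edge belonging to `T`. -/
def subgraphOf (T : Set M.Edge) : SimpleGraph M.Vertex where
  Adj u v := u ≠ v ∧ ∃ d, M.edge d ∈ T ∧ M.origin d = u ∧ M.origin (M.opp d) = v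
  symm := ⟨by
    rintro u v ⟨huv, d, hd, hu, hv⟩
    refine ⟨huv.symm, M.opp d, ?_, hv, ?_⟩
    · have h : M.edge (M.opp d) = M.edge d :=
        Quotient.sound (Equiv.Perm.sameCycle_apply_left.2 (Equiv.Perm.SameCycle.refl _ _))
      rw [h]
      exact hd
    · rw [M.opp_opp]
      exact hu⟩
  loopless := ⟨fun _ h => h.1 rfl⟩

/-- A set `T` of edges is (the edge set of) a spanning tree: `T` contains neither loops nor
multiple edges, and the graph formed by all the vertices of the map and the edges in `T`
is a tree. -/
def IsSpanningTree (T : Set M.Edge) : Prop :=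
  (∀ d, M.edge d ∈ T → M.origin d ≠ M.origin (M.opp d)) ∧
  (∀ d d', M.edge d ∈ T → M.edge d' ∈ T → M.origin d = M.origin d' →
    M.origin (M.opp d) = M.origin (M.opp d') → d = d') ∧
  (M.subgraphOf T).IsTree

end RotationSystem

/-- Tree-rooted planar maps, before identifying isomorphic ones: the atomic map (one vertex, one
face, no edge, the empty spanning tree), or a planar map on a finite set `D` of darts with a root
dart (an oriented edge) and a distinguished spanning tree. -/
inductive TreeRootedMap : Type 1
  | atomic : TreeRootedMap
  | ofDarts (D : Type) (finite : Finite D) (M : RotationSystem D) (planar : M.IsPlanar)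
      (root : D) (T : Set M.Edge) (tree : M.IsSpanningTree T) : TreeRootedMap

namespace TreeRootedMap

/-- The number of vertices. -/
noncomputable def numVertices : TreeRootedMap → ℕ
  | atomic => 1
  | ofDarts _ _ M _ _ _ _ => Nat.card M.Vertex

/-- The number of edges. -/
noncomputable def numEdges : TreeRootedMap → ℕ
  | atomic => 0
  | ofDarts _ _ M _ _ _ _ => Nat.card M.Edge

/-- The number of faces. -/
noncomputable def numFaces : TreeRootedMap → ℕ
  | atomic => 1
  | ofDarts _ _ M _ _ _ _ => Nat.card M.Face

/-- Isomorphism (orientation-preserving homeomorphism) of tree-rooted maps: a bijection between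
the darts that preserves the rotation system, the root and the spanning tree. -/
def Iso : TreeRootedMap → TreeRootedMap → Prop
  | atomic, atomic => True
  | ofDarts D _ M _ r T _, ofDarts D' _ M' _ r' T' _ =>
      ∃ e : D ≃ D', (∀ d, e (M.next d) = M'.next (e d)) ∧ (∀ d, e (M.opp d) = M'.opp (e d)) ∧
        e r = r' ∧ ∀ d, M.edge d ∈ T ↔ M'.edge (e d) ∈ T'
  | _, _ => False

theorem Iso.refl : ∀ X : TreeRootedMap, Iso X X
  | atomic => trivial
  | ofDarts D _ _ _ _ _ _ =>
      ⟨Equiv.refl D, fun _ => rfl, fun _ => rfl, rfl, fun _ => Iff.rfl⟩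

theorem Iso.symm : ∀ {X Y : TreeRootedMap}, Iso X Y → Iso Y X
  | atomic, atomic, _ => trivial
  | ofDarts _ _ _ _ _ _ _, ofDarts _ _ _ _ _ _ _, ⟨e, hn, ho, hr, hT⟩ =>
      ⟨e.symm, fun d => by rw [Equiv.symm_apply_eq, hn, e.apply_symm_apply],
        fun d => by rw [Equiv.symm_apply_eq, ho, e.apply_symm_apply],
        by rw [Equiv.symm_apply_eq, hr], fun d => by rw [hT, e.apply_symm_apply]⟩

theorem Iso.trans : ∀ {X Y Z : TreeRootedMap}, Iso X Y → Iso Y Z → Iso X Z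
  | atomic, atomic, atomic, _, _ => trivial
  | ofDarts _ _ _ _ _ _ _, ofDarts _ _ _ _ _ _ _, ofDarts _ _ _ _ _ _ _,
      ⟨e, hn, ho, hr, hT⟩, ⟨e', hn', ho', hr', hT'⟩ =>
      ⟨e.trans e', fun d => by simp [hn, hn'], fun d => by simp [ho, ho'], by simp [hr, hr'],
        fun d => by rw [hT, hT', Equiv.trans_apply]⟩

instance isoSetoid : Setoid TreeRootedMap where
  r := Iso
  iseqv := ⟨Iso.refl, Iso.symm, Iso.trans⟩

/-- The number of tree-rooted planar maps (up to isomorphism) with `n` edges. -/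
noncomputable def countEdges (n : ℕ) : ℕ :=
  ((Quotient.mk isoSetoid) '' {X : TreeRootedMap | X.numEdges = n}).ncard

/-- The number of tree-rooted planar maps (up to isomorphism) with `v` vertices and `f` faces. -/
noncomputable def countVerticesFaces (v f : ℕ) : ℕ :=
  ((Quotient.mk isoSetoid) ''
    {X : TreeRootedMap | X.numVertices = v ∧ X.numFaces = f}).ncard

/-- The generating function of tree-rooted planar maps, counted by edges. -/
noncomputable def edgeSeries : PowerSeries ℚ :=
  PowerSeries.mk fun n => (countEdges n : ℚ)

/-- The generating function `∑ TR(i, j) w ^ i z ^ j`, where `w` and `z` are the variables of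
index `0` and `1` and `TR(i, j)` is the number of tree-rooted planar maps with `i + 1` vertices
and `j + 1` faces. -/
noncomputable def vertexFaceSeries : MvPowerSeries (Fin 2) ℚ :=
  fun m => (countVerticesFaces (m 0 + 1) (m 1 + 1) : ℚ)

end TreeRootedMap

/-- A power series `F` over a field `K` is D-finite if, for each variable `x_i`, it satisfies a
non-trivial linear differential equation `∑_{k ≤ r} p_k (∂/∂x_i)^k F = 0` whose coefficients
`p_k` are polynomials in all the variables. -/
def IsDFinite {σ K : Type*} [Field K] (F : MvPowerSeries σ K) : Prop :=
  ∀ i : σ, ∃ (r : ℕ) (p : ℕ → MvPolynomial σ K), p r ≠ 0 ∧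
    ∑ k ∈ Finset.range (r + 1),
      (p k : MvPowerSeries σ K) * (fun G => MvPowerSeries.pderiv (R := K) i G)^[k] F = 0

/-! The count rests on Mullin's decomposition of a tree-rooted map. Walk around the spanning tree
`T`: the permutation `M.tour T = next * flip T` follows the darts of `T` and crosses the others. It
is obtained from `next` by adding the tree edges one at a time; each merges two cycles, so the tour
is a single cycle through all `2n` darts. Numbering the darts along it from the root turns it into
the rotation `c` of `Fin (2n)`, while `opp` becomes the product of two involutions with
complementary supports: `ι` pairs the tree darts and `κ` pairs the others. Vertices are the cycles
of `c * ι`, and faces those of `c * κ`.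

A product of `c` with `k` disjoint transpositions has at most `k + 1` cycles, with equality exactly
when no two pairs cross (`Fin.two_mul_numCycles_of_isNoncrossing`,
`Fin.isNoncrossing_of_two_mul_numCycles`). A spanning tree has one edge fewer than there are
vertices, and Euler's formula gives the same relation between non-tree edges and faces; these are
the two equality cases. Hence a tree-rooted map is the same as a set `S` of steps with noncrossing
perfect matchings of `S` and of its complement (`eq_of_iso_ofCode`, `exists_iso_ofCode`). The count
by vertices and faces is `(2i+2j).choose (2i) * catalan i * catalan j`, and Vandermonde's identity
sums it over `i + j = n`.

For D-finiteness, the closed forms give coefficient recurrences, which become relations between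
Euler operators `x ∂/∂x`. These place the series in a finitely generated module over the polynomials
that is stable under `q ∂/∂x` for some `q ≠ 0`; linear dependence of the derivatives follows. -/

/-! ### Cycles of a permutation and multiplication by transpositions. -/

namespace Equiv.Perm

variable {α β : Type*}

/-- The number of cycles of a permutation, fixed points included. -/
noncomputable def numCycles (π : Perm α) : ℕ := Nat.card (Quotient (SameCycle.setoid π))

/-- On a finite type every element of a cycle is a forward iterate of any other, so forward
stability is enough. This is the induction principle along cycles used throughout. -/
theorem SameCycle.mem_of_forall_apply_mem [Finite α] {π : Perm α} {x y : α}
    (h : π.SameCycle x y) {A : Set α} (hA : ∀ z ∈ A, π z ∈ A) (hx : x ∈ A) : y ∈ A := by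
  obtain ⟨n, rfl⟩ := h.exists_nat_pow_eq
  clear h
  induction n with
  | zero => exact hx
  | succ n ih => rw [pow_succ']; exact hA _ ih

theorem numCycles_conj (π : Perm α) (ρ : Perm β) (e : α ≃ β) (h : ∀ x, e (π x) = ρ (e x)) :
    numCycles π = numCycles ρ := by
  have hz : ∀ x y, π.SameCycle x y → ρ.SameCycle (e x) (e y) := by
    rintro x y ⟨n, rfl⟩
    have hρ : ρ = e.permCongr π := by ext x; simp [Equiv.permCongr_apply, h]
    refine ⟨n, ?_⟩
    have := map_zpow (e.permCongrHom) π n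
    have h2 := congrArg (fun f : Perm β => f (e x)) this
    simpa [hρ] using h2.symm
  have hz' : ∀ x y, ρ.SameCycle x y → π.SameCycle (e.symm x) (e.symm y) := by
    rintro x y ⟨n, rfl⟩
    have hρ : π = e.symm.permCongr ρ := by
      ext x; simp [Equiv.permCongr_apply, ← h]
    refine ⟨n, ?_⟩
    have := map_zpow (e.symm.permCongrHom) ρ n
    have h2 := congrArg (fun f : Perm α => f (e.symm x)) this
    simpa [hρ] using h2.symm
  refine Nat.card_congr (Quotient.congr e fun x y => ⟨hz x y, fun hxy => ?_⟩)
  have := hz' _ _ hxy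
  rwa [e.symm_apply_apply, e.symm_apply_apply] at this

variable [DecidableEq α]

/-- The new permutation sends `x` to `π y` and then agrees with `π` along the old cycle of `y`,
which avoids `x`, until it reaches `y`. -/
theorem sameCycle_mul_swap [Finite α] {π : Perm α} {x y : α} (h : ¬ π.SameCycle x y) :
    (π * swap x y).SameCycle x y := by
  by_contra hxy
  have hx : (π * swap x y) x = π y := by simp
  have hc : π.SameCycle (π y) y := sameCycle_apply_left.2 (SameCycle.refl _ _)
  have key := hc.mem_of_forall_apply_mem
    (A := {u | (π * swap x y).SameCycle x u ∧ π.SameCycle y u}) ?_ ?_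
  · exact hxy key.1
  · rintro u ⟨h1, h2⟩
    have hux : u ≠ x := by rintro rfl; exact h h2.symm
    have huy : u ≠ y := by rintro rfl; exact hxy h1
    refine ⟨?_, sameCycle_apply_right.2 h2⟩
    have : (π * swap x y) u = π u := by simp [swap_apply_of_ne_of_ne hux huy]
    rw [← this]
    exact sameCycle_apply_right.2 h1
  · refine ⟨?_, sameCycle_apply_right.2 (SameCycle.refl _ _)⟩
    rw [← hx]
    exact sameCycle_apply_right.2 (SameCycle.refl _ _)

theorem not_sameCycle_mul_swap [Finite α] {π : Perm α} {x y : α} (hne : x ≠ y)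
    (h : π.SameCycle x y) : ¬ (π * swap x y).SameCycle x y := by
  intro hs
  have hex : ∃ k : ℕ, (π ^ k) x = y := h.exists_nat_pow_eq
  classical
  set k := Nat.find hex with hk
  have hky : (π ^ k) x = y := Nat.find_spec hex
  have hk0 : k ≠ 0 := by
    intro h0
    rw [h0] at hky
    exact hne hky
  -- The arc from `π x` to the first visit `π ^ k x = y` is closed up by the new permutation, since
  -- `y` now goes to `π x`; minimality of `k` keeps `x` out of it.
  have key := hs.symm.mem_of_forall_apply_mem (A := {u | ∃ i, 1 ≤ i ∧ i ≤ k ∧ (π ^ i) x = u})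
    ?_ ⟨k, by omega, le_refl _, hky⟩
  · obtain ⟨i, h1, h2, h3⟩ := key
    have h4 : (π ^ (k - i)) x = y := by
      rw [← hky]
      conv_rhs => rw [show k = (k - i) + i by omega, pow_add, mul_apply, h3]
    have := Nat.find_min' hex h4
    omega
  · rintro u ⟨i, h1, h2, rfl⟩
    have hx : (π ^ i) x ≠ x := by
      intro h3
      have h4 : (π ^ (k - i)) x = y := by
        rw [← hky]
        conv_rhs => rw [show k = (k - i) + i by omega, pow_add, mul_apply, h3]
      have := Nat.find_min' hex h4
      omega
    rcases eq_or_lt_of_le h2 with rfl | hlt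
    · exact ⟨1, le_refl _, h1, by simp [hky]⟩
    · have hy : (π ^ i) x ≠ y := fun h3 => Nat.find_min hex hlt h3
      exact ⟨i + 1, by omega, hlt, by simp [swap_apply_of_ne_of_ne hx hy, pow_succ']⟩

/-- Multiplication by a transposition of two elements of different cycles merges the cycles. -/
theorem numCycles_mul_swap_of_not_sameCycle [Finite α] {π : Perm α} {x y : α}
    (h : ¬ π.SameCycle x y) : numCycles (π * swap x y) + 1 = numCycles π := by
  have hxy := sameCycle_mul_swap h
  have hstep : ∀ u, (π * swap x y).SameCycle u (π u) := by
    intro u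
    rcases eq_or_ne u x with rfl | hux
    · refine hxy.trans ?_
      have : (π * swap u y) y = π u := by simp
      rw [← this]
      exact sameCycle_apply_right.2 (SameCycle.refl _ _)
    rcases eq_or_ne u y with rfl | huy
    · refine hxy.symm.trans ?_
      have : (π * swap x u) x = π u := by simp
      rw [← this]
      exact sameCycle_apply_right.2 (SameCycle.refl _ _)
    have : (π * swap x y) u = π u := by simp [swap_apply_of_ne_of_ne hux huy]
    rw [← this]
    exact sameCycle_apply_right.2 (SameCycle.refl _ _)
  have hle : ∀ u v, π.SameCycle u v → (π * swap x y).SameCycle u v := by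
    intro u v huv
    exact huv.mem_of_forall_apply_mem (A := {v | (π * swap x y).SameCycle u v})
      (fun z hz => SameCycle.trans hz (hstep z)) (SameCycle.refl _ _)
  have hge : ∀ u v, (π * swap x y).SameCycle u v → π.SameCycle u v ∨
      ((π.SameCycle x u ∨ π.SameCycle y u) ∧ (π.SameCycle x v ∨ π.SameCycle y v)) := by
    intro u v huv
    refine huv.mem_of_forall_apply_mem (A := {v | π.SameCycle u v ∨
      ((π.SameCycle x u ∨ π.SameCycle y u) ∧ (π.SameCycle x v ∨ π.SameCycle y v))})
      (fun z hz => ?_) (Or.inl (SameCycle.refl _ _))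
    simp only [Set.mem_ofPred_eq] at hz ⊢
    rcases eq_or_ne z x with rfl | hux
    · right
      simp only [mul_apply, swap_apply_left, sameCycle_apply_right, SameCycle.refl, or_true,
        and_true]
      rcases hz with hz | hz
      · exact Or.inl hz.symm
      · exact hz.1
    rcases eq_or_ne z y with rfl | huy
    · right
      simp only [mul_apply, swap_apply_right, sameCycle_apply_right, SameCycle.refl, true_or,
        and_true]
      rcases hz with hz | hz
      · exact Or.inr hz.symm
      · exact hz.1
    simpa only [mul_apply, swap_apply_of_ne_of_ne hux huy, sameCycle_apply_right] using hz
  let q : Quotient (SameCycle.setoid π) → Quotient (SameCycle.setoid (π * swap x y)) :=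
    Quotient.map id hle
  -- The old cycles map onto the new ones, and only those of `x` and `y` are identified; discarding
  -- the cycle of `x` leaves a bijection.
  have hq : Function.Bijective
      (fun a : {a : Quotient (SameCycle.setoid π) // a ≠ Quotient.mk _ x} => q a.1) := by
    constructor
    · rintro ⟨a, ha⟩ ⟨b, hb⟩ hab
      induction a using Quotient.inductionOn with | h a => ?_
      induction b using Quotient.inductionOn with | h b => ?_
      have ha' : ¬ π.SameCycle x a := fun h => ha (Quotient.sound h.symm)
      have hb' : ¬ π.SameCycle x b := fun h => hb (Quotient.sound h.symm)
      have := hge a b (Quotient.exact hab)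
      refine Subtype.ext (Quotient.sound ?_)
      rcases this with h | ⟨h1 | h1, h2 | h2⟩
      · exact h
      · exact absurd h1 ha'
      · exact absurd h1 ha'
      · exact absurd h2 hb'
      · exact h1.symm.trans h2
    · intro b
      induction b using Quotient.inductionOn with | h b => ?_
      by_cases hb : π.SameCycle x b
      · refine ⟨⟨Quotient.mk _ y, fun h' => h (Quotient.exact h').symm⟩, Quotient.sound ?_⟩
        exact hxy.symm.trans (hle _ _ hb)
      · exact ⟨⟨Quotient.mk _ b, fun h' => hb (Quotient.exact h').symm⟩, rfl⟩
  have hcard := Nat.card_eq_of_bijective _ hq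
  unfold numCycles
  rw [← hcard]
  have := Fintype.ofFinite (Quotient (SameCycle.setoid π))
  classical
  have hpos : 0 < Fintype.card (Quotient (SameCycle.setoid π)) :=
    Fintype.card_pos_iff.2 ⟨Quotient.mk _ x⟩
  rw [Nat.card_eq_fintype_card, Nat.card_eq_fintype_card, Fintype.card_subtype_compl,
    Fintype.card_subtype_eq]
  omega

/-- Multiplication by a transposition of two elements of the same cycle splits the cycle. -/
theorem numCycles_mul_swap_of_sameCycle [Finite α] {π : Perm α} {x y : α} (hne : x ≠ y)
    (h : π.SameCycle x y) : numCycles (π * swap x y) = numCycles π + 1 := by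
  have := numCycles_mul_swap_of_not_sameCycle (not_sameCycle_mul_swap hne h)
  rw [mul_assoc, swap_mul_self, mul_one] at this
  exact this.symm

theorem numCycles_mul_swap_le [Finite α] (π : Perm α) (x y : α) :
    numCycles (π * swap x y) ≤ numCycles π + 1 := by
  by_cases h : π.SameCycle x y
  · rcases eq_or_ne x y with rfl | hne
    · rw [swap_self]
      exact Nat.le_succ _
    · exact (numCycles_mul_swap_of_sameCycle hne h).le
  · have := numCycles_mul_swap_of_not_sameCycle h
    omega

/-- Multiplying by `swap x (ι x)` deletes the pair `{x, ι x}` and makes both points fixed. -/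
theorem involutive_mul_swap {ι : Perm α} (hι : Function.Involutive ι) (x : α) :
    Function.Involutive (ι * swap x (ι x)) := by
  have := hι.injective
  intro z
  simp only [mul_apply, swap_apply_def]
  have h2 := hι x
  have h3 := hι z
  by_cases h1 : z = x <;> by_cases h2 : z = ι x <;> grind

theorem mul_swap_mul_swap_apply (ι : Perm α) (x : α) :
    ι * swap x (ι x) * swap x (ι x) = ι := by
  rw [mul_assoc, swap_mul_self, mul_one]

variable [Fintype α]

theorem support_mul_swap_apply {ι : Perm α} (hι : Function.Involutive ι) (x : α) :
    (ι * swap x (ι x)).support = (ι.support.erase x).erase (ι x) := by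
  ext z
  simp only [mem_support, mul_apply, swap_apply_def, Finset.mem_erase]
  have h2 := hι x
  by_cases h1 : z = x <;> by_cases h2 : z = ι x <;> grind

theorem card_support_mul_swap_apply {ι : Perm α} (hι : Function.Involutive ι) {x : α}
    (hx : ι x ≠ x) : (ι * swap x (ι x)).support.card + 2 = ι.support.card := by
  have h1 : x ∈ ι.support := mem_support.2 hx
  have h2 : ι x ∈ ι.support.erase x :=
    Finset.mem_erase.2 ⟨hx, mem_support.2 fun h => hx (ι.injective h)⟩
  rw [support_mul_swap_apply hι, ← Finset.card_erase_add_one h1, ← Finset.card_erase_add_one h2]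

/-- Induction on the number of transpositions in an involution. -/
theorem involutive_induction {P : Perm α → Prop} (one : P 1)
    (step : ∀ (ι : Perm α) (x : α), Function.Involutive ι → ι x ≠ x →
      P (ι * swap x (ι x)) → P ι) (ι : Perm α) (hι : Function.Involutive ι) : P ι := by
  induction hn : ι.support.card using Nat.strong_induction_on generalizing ι with
  | _ n ih =>
    by_cases h1 : ι = 1
    · exact h1 ▸ one
    · obtain ⟨x, hx⟩ : ∃ x, ι x ≠ x := by
        by_contra! h
        exact h1 (Equiv.ext h)
      have := card_support_mul_swap_apply hι hx
      exact step ι x hι hx (ih _ (by omega) _ (involutive_mul_swap hι x) rfl)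

/-- Each of the `ι.support.card / 2` transpositions of `ι` creates at most one cycle. -/
theorem two_mul_numCycles_mul_le (π ι : Perm α) (hι : Function.Involutive ι) :
    2 * numCycles (π * ι) ≤ 2 * numCycles π + ι.support.card := by
  refine involutive_induction (P := fun ι => 2 * numCycles (π * ι) ≤
    2 * numCycles π + ι.support.card) (by simp) (fun ι x hι hx ih => ?_) ι hι
  have h1 := card_support_mul_swap_apply hι hx
  have h2 := numCycles_mul_swap_le (π * (ι * swap x (ι x))) x (ι x)
  rw [mul_assoc, mul_swap_mul_swap_apply] at h2
  omega

end Equiv.Perm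

/-! ### Noncrossing involutions as the genus-zero case of a cycle count. -/

section Noncrossing

open Equiv Equiv.Perm

/-- No two of the pairs `{x, f x}` of an involution `f` cross. -/
def IsNoncrossing {α : Type*} [LT α] (f : α → α) : Prop :=
  ∀ x y, x < y → y < f x → f y < f x

/-- The definition bounds `f y` only from above. If `f y < x`, applying it to the pair starting at
`f y` would give `f x < y`. -/
theorem IsNoncrossing.lt_apply {α : Type*} [LinearOrder α] {f : α → α} (h : IsNoncrossing f)
    (hf : Function.Involutive f) {x y : α} (hxy : x < y) (hy : y < f x) : x < f y := by
  by_contra! hlt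
  rcases eq_or_lt_of_le hlt with h1 | h1
  · rw [← h1, hf] at hy
    exact lt_irrefl _ hy
  · have := h (f y) x h1 (by rwa [hf])
    rw [hf] at this
    exact absurd hy this.not_gt

namespace Fin

variable {m : ℕ} [NeZero m]

theorem val_add_one_of_lt_of {z b : Fin m} (h : z < b) : (z + 1).val = z.val + 1 := by
  obtain ⟨k, rfl⟩ : ∃ k, m = k + 1 := ⟨m - 1, by have := NeZero.pos m; omega⟩
  exact Fin.val_add_one_of_lt (lt_of_lt_of_le h (Fin.le_last b))

theorem sameCycle_of_forall_apply_eq_add_one {π : Perm (Fin m)} {a b : Fin m} (hab : a ≤ b)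
    (h : ∀ z, a ≤ z → z < b → π z = z + 1) : π.SameCycle a b := by
  have key : ∀ k (hk : a.val + k < m), a.val + k ≤ b.val → π.SameCycle a ⟨a.val + k, hk⟩ := by
    intro k
    induction k with
    | zero => intro _ _; exact SameCycle.refl _ _
    | succ k ih =>
      intro hk hkb
      refine (ih (by omega) (by omega)).trans ?_
      have hlt : (⟨a.val + k, by omega⟩ : Fin m) < b := Fin.lt_def.2 (by simp; omega)
      have h1 := h ⟨a.val + k, by omega⟩ (Fin.le_def.2 (by simp)) hlt
      have h2 : (⟨a.val + (k + 1), hk⟩ : Fin m) = ⟨a.val + k, by omega⟩ + 1 :=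
        Fin.ext (by rw [val_add_one_of_lt_of hlt]; rfl)
      rw [h2, ← h1]
      exact sameCycle_apply_right.2 (SameCycle.refl _ _)
  have := key (b.val - a.val) (by omega) (by omega)
  convert this using 1
  ext
  simp only
  omega

theorem numCycles_addRight_one : numCycles (Equiv.addRight (1 : Fin m)) = 1 := by
  rw [numCycles, Nat.card_eq_one_iff_unique]
  refine ⟨⟨fun a b => ?_⟩, ⟨Quotient.mk _ 0⟩⟩
  have h0 : ∀ a, (Equiv.addRight (1 : Fin m)).SameCycle 0 a := fun a =>
    sameCycle_of_forall_apply_eq_add_one (Fin.le_def.2 (Nat.zero_le _)) fun z _ _ => rfl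
  induction a using Quotient.inductionOn with | h a => ?_
  induction b using Quotient.inductionOn with | h b => ?_
  exact Quotient.sound ((h0 a).symm.trans (h0 b))

/-- The chord cuts the rotation at `a` and `b`: the point `b` returns to `a + 1`, so the interval
`(a, b]` is closed. -/
theorem mem_Ioc_of_sameCycle_addRight_one_mul_swap {a b u v : Fin m} (hab : a < b)
    (h : (Equiv.addRight (1 : Fin m) * swap a b).SameCycle u v) (hu : u ∈ Set.Ioc a b) :
    v ∈ Set.Ioc a b := by
  refine h.mem_of_forall_apply_mem (fun z hz => ?_) hu
  obtain ⟨hz1, hz2⟩ := hz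
  rcases eq_or_lt_of_le hz2 with rfl | hlt
  · have h1 := val_add_one_of_lt_of hab
    have h2 : (Equiv.addRight (1 : Fin m) * swap a z) z = a + 1 := by simp
    rw [h2]
    refine ⟨?_, ?_⟩ <;> simp only [Fin.lt_def, Fin.le_def] at * <;> omega
  · have h1 := val_add_one_of_lt_of hlt
    have h2 : (Equiv.addRight (1 : Fin m) * swap a b) z = z + 1 := by
      simp [swap_apply_of_ne_of_ne hz1.ne' hlt.ne]
    rw [h2]
    refine ⟨?_, ?_⟩ <;> simp only [Fin.lt_def, Fin.le_def] at * <;> omega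

theorem two_mul_numCycles_of_isNoncrossing (ι : Perm (Fin m)) (hι : Function.Involutive ι)
    (hnc : IsNoncrossing ι) :
    2 * numCycles (Equiv.addRight (1 : Fin m) * ι) = 2 + ι.support.card := by
  induction hn : ι.support.card using Nat.strong_induction_on generalizing ι with
  | _ n ih =>
    by_cases h1 : ι = 1
    · subst h1
      simp only [support_one, Finset.card_empty] at hn
      rw [mul_one, numCycles_addRight_one, ← hn]
    · obtain ⟨x0, hx0⟩ : ∃ x, x < ι x := by
        by_contra! h
        refine h1 (Equiv.ext fun x => le_antisymm (h x) ?_)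
        simpa [hι x] using h (ι x)
      -- A shortest pair has only fixed points strictly inside: a pair meeting its interior would be
      -- nested, hence shorter. The smaller product therefore runs from `x` straight to `ι x`, and
      -- restoring the pair splits that cycle.
      obtain ⟨x, hx, hmin⟩ := Finset.exists_min_image (Finset.univ.filter fun x => x < ι x)
        (fun x => (ι x).val - x.val) ⟨x0, by simpa using hx0⟩
      simp only [Finset.mem_filter, Finset.mem_univ, true_and] at hx hmin
      have hfix : ∀ z, x < z → z < ι x → ι z = z := by
        intro z hz1 hz2
        have h2 := hnc x z hz1 hz2
        have h3 := hnc.lt_apply hι hz1 hz2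
        by_contra hne
        rcases lt_or_gt_of_ne hne with h | h
        · have := hmin (ι z) (by rwa [hι])
          rw [hι] at this
          simp only [Fin.lt_def] at *
          omega
        · have := hmin z h
          simp only [Fin.lt_def] at *
          omega
      have hcard := card_support_mul_swap_apply hι hx.ne'
      have happ : ∀ z, z ≠ x → z ≠ ι x → (ι * swap x (ι x)) z = ι z := fun z hz1 hz2 => by
        simp [swap_apply_of_ne_of_ne hz1 hz2]
      have hx1 : (ι * swap x (ι x)) x = x := by simp [hι x]
      have hx2 : (ι * swap x (ι x)) (ι x) = ι x := by simp
      have hih := ih _ (by omega) (ι * swap x (ι x)) (involutive_mul_swap hι x) (by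
        intro a b hab hb
        have ha1 : a ≠ x := by rintro rfl; rw [hx1] at hb; exact absurd hb hab.not_gt
        have ha2 : a ≠ ι x := by rintro rfl; rw [hx2] at hb; exact absurd hb hab.not_gt
        by_cases hb1 : b = x
        · subst hb1; rwa [hx1]
        by_cases hb2 : b = ι x
        · subst hb2; rwa [hx2]
        rw [happ a ha1 ha2] at hb ⊢
        rw [happ b hb1 hb2]
        exact hnc a b hab hb) rfl
      have hsame : (Equiv.addRight (1 : Fin m) * (ι * swap x (ι x))).SameCycle x (ι x) := by
        refine sameCycle_of_forall_apply_eq_add_one hx.le fun z hz1 hz2 => ?_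
        rw [Perm.mul_apply]
        rcases eq_or_lt_of_le hz1 with rfl | hz1
        · rw [hx1]; rfl
        · rw [happ z hz1.ne' hz2.ne, hfix z hz1 hz2]; rfl
      have := numCycles_mul_swap_of_sameCycle hx.ne hsame
      rw [mul_assoc, mul_swap_mul_swap_apply] at this
      omega

/-- Suppose `x < y < ι x < ι y`. Multiplying the rotation by the second pair gives at most two
cycles, and these separate `x` from `ι x`; the first pair then merges two cycles instead of
splitting one. The other pairs add at most one cycle each, so the maximum is missed. -/
theorem isNoncrossing_of_two_mul_numCycles (ι : Perm (Fin m)) (hι : Function.Involutive ι)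
    (h : 2 * numCycles (Equiv.addRight (1 : Fin m) * ι) = 2 + ι.support.card) :
    IsNoncrossing ι := by
  intro x y hxy hy
  by_contra! hle
  have hlt : ι x < ι y := lt_of_le_of_ne hle fun h' => hxy.ne (ι.injective h')
  have hxι : x < ι x := hxy.trans hy
  have hyι : y < ι y := hy.trans hlt
  have c1 : ι * swap x (ι x) = swap x (ι x) * ι := by
    rw [mul_swap_eq_swap_mul, hι, swap_comm]
  have c2 : ι * swap y (ι y) = swap y (ι y) * ι := by
    rw [mul_swap_eq_swap_mul, hι, swap_comm]
  have hinv := involutive_mul_swap hι x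
  have happ : (ι * swap x (ι x)) y = ι y := by
    simp [swap_apply_of_ne_of_ne hxy.ne' hy.ne]
  have k1 := card_support_mul_swap_apply hι hxι.ne'
  have k2 := card_support_mul_swap_apply hinv (x := y) (by rw [happ]; exact hyι.ne')
  have k3 := two_mul_numCycles_mul_le
    (Equiv.addRight (1 : Fin m) * swap y (ι y) * swap x (ι x)) _ (involutive_mul_swap hinv y)
  -- An involution commutes with each of its own transpositions, so the two extracted pairs can be
  -- moved to the front.
  have hprod : swap y (ι y) * swap x (ι x) * (ι * swap x (ι x) * swap y (ι y)) = ι := by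
    rw [c1, mul_assoc (swap x (ι x)) ι, c2]
    simp only [← mul_assoc, swap_mul_self, one_mul, mul_assoc (swap y (ι y)) (swap x (ι x))
      (swap x (ι x)), mul_one]
  rw [happ] at k3 k2
  rw [mul_assoc, mul_assoc, ← mul_assoc (swap y (ι y)), hprod] at k3
  have k4 := numCycles_mul_swap_le (Equiv.addRight (1 : Fin m)) y (ι y)
  have k5 := numCycles_mul_swap_of_not_sameCycle (x := x) (y := ι x)
    (π := Equiv.addRight (1 : Fin m) * swap y (ι y)) (fun hs =>
      absurd (mem_Ioc_of_sameCycle_addRight_one_mul_swap hyι hs.symm ⟨hy, hlt.le⟩).1 hxy.not_gt)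
  rw [numCycles_addRight_one] at k4
  omega

end Fin

end Noncrossing

/-! ### Noncrossing perfect matchings are counted by Catalan numbers. -/

section NoncrossingCount

variable {α : Type*} [LinearOrder α] [Fintype α]

open Classical in
/-- The noncrossing perfect matchings of `S`, as involutions whose non-fixed points form `S`. -/
noncomputable def noncrossingMatchings (S : Finset α) : Finset (α → α) :=
  Finset.univ.filter fun f => Function.Involutive f ∧ IsNoncrossing f ∧ ∀ x, f x ≠ x ↔ x ∈ S

theorem mem_noncrossingMatchings {S : Finset α} {f : α → α} :
    f ∈ noncrossingMatchings S ↔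
      Function.Involutive f ∧ IsNoncrossing f ∧ ∀ x, f x ≠ x ↔ x ∈ S := by
  simp [noncrossingMatchings]

omit [Fintype α] in
theorem restrict_spec {f : α → α} (hf : Function.Involutive f) (hnc : IsNoncrossing f)
    (A : Finset α) (hA : ∀ x ∈ A, f x ∈ A) (hne : ∀ x ∈ A, f x ≠ x) :
    Function.Involutive (fun x => if x ∈ A then f x else x) ∧
      IsNoncrossing (fun x => if x ∈ A then f x else x) ∧
      ∀ x, (if x ∈ A then f x else x) ≠ x ↔ x ∈ A := by
  refine ⟨fun x => ?_, fun x y hxy hy => ?_, fun x => ?_⟩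
  · by_cases hx : x ∈ A
    · simp [hx, hA x hx, hf x]
    · simp [hx]
  · by_cases hx : x ∈ A
    · simp only [hx, if_true] at hy ⊢
      split_ifs
      · exact hnc x y hxy hy
      · exact hy
    · simp only [hx, if_false] at hy
      exact absurd hxy hy.not_gt
  · by_cases hx : x ∈ A
    · simp [hx, hne x hx]
    · simp [hx]

/-- The chord from the least element `a` to `y` separates the points below `y` from those above, so
the matching restricts to both sides; conversely two matchings glue together along this chord. -/
theorem card_noncrossingMatchings_fiber {S : Finset α} {a y : α} (ha : a ∈ S)
    (hmin : ∀ z ∈ S, a ≤ z) (hy : y ∈ S) (hya : y ≠ a) :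
    ((noncrossingMatchings S).filter fun f => f a = y).card =
      (noncrossingMatchings ((S.erase a).filter (· < y))).card *
        (noncrossingMatchings ((S.erase a).filter (y < ·))).card := by
  have hay : a < y := lt_of_le_of_ne (hmin y hy) hya.symm
  rw [← Finset.card_product]
  refine Finset.card_nbij'
    (fun f => (fun x => if x ∈ (S.erase a).filter (· < y) then f x else x,
      fun x => if x ∈ (S.erase a).filter (y < ·) then f x else x))
    (fun p x => if x = a then y else if x = y then a else if x < y then p.1 x else p.2 x)
    ?_ ?_ ?_ ?_
  · intro f hf
    rw [Finset.coe_filter, Set.mem_ofPred_eq, mem_noncrossingMatchings] at hf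
    obtain ⟨⟨h1, h2, h3⟩, h4⟩ := hf
    rw [Finset.mem_coe, Finset.mem_product, mem_noncrossingMatchings, mem_noncrossingMatchings]
    have hS : ∀ x ∈ S, f x ∈ S := fun x hx => by
      rw [← h3, h1]; exact ((h3 x).2 hx).symm
    refine ⟨restrict_spec h1 h2 _ (fun x hx => ?_) (fun x hx => ?_),
      restrict_spec h1 h2 _ (fun x hx => ?_) (fun x hx => ?_)⟩
    · simp only [Finset.mem_filter, Finset.mem_erase] at hx ⊢
      have hax : a < x := lt_of_le_of_ne (hmin x hx.1.2) hx.1.1.symm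
      have := h2 a x hax (by rw [h4]; exact hx.2)
      have h6 := h2.lt_apply h1 hax (by rw [h4]; exact hx.2)
      exact ⟨⟨h6.ne', hS x hx.1.2⟩, h4 ▸ this⟩
    · exact (h3 x).2 (Finset.mem_of_mem_erase (Finset.mem_filter.1 hx).1)
    · simp only [Finset.mem_filter, Finset.mem_erase] at hx ⊢
      have hfa : f x ≠ a := fun h => by
        have := h1 x
        rw [h, h4] at this
        exact hx.2.ne this
      have hfy : f x ≠ y := fun h => by
        rw [← h4] at h
        exact hx.1.1 (h1.injective h)
      refine ⟨⟨hfa, hS x hx.1.2⟩, ?_⟩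
      by_contra! hle
      have h6 : a < f x := lt_of_le_of_ne (hmin _ (hS x hx.1.2)) hfa.symm
      have h7 := h2 a (f x) h6 (by rw [h4]; exact lt_of_le_of_ne hle hfy)
      rw [h1, h4] at h7
      exact absurd hx.2 h7.not_gt
    · exact (h3 x).2 (Finset.mem_of_mem_erase (Finset.mem_filter.1 hx).1)
  · rintro ⟨p, q⟩ hpq
    rw [Finset.mem_coe, Finset.mem_product, mem_noncrossingMatchings,
      mem_noncrossingMatchings] at hpq
    obtain ⟨⟨p1, p2, p3⟩, q1, q2, q3⟩ := hpq
    simp only [Finset.mem_filter, Finset.mem_erase] at p1 p2 p3 q1 q2 q3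
    rw [Finset.coe_filter, Set.mem_ofPred_eq, mem_noncrossingMatchings]
    have hp : ∀ x, p x = x ∨ (p x ≠ a ∧ p x ∈ S ∧ p x < y ∧ x ≠ a ∧ x ∈ S ∧ x < y) := by
      intro x
      by_cases h : p x = x
      · exact Or.inl h
      · have := (p3 x).1 h
        have h2 := (p3 (p x)).1 (by rw [p1]; exact Ne.symm h)
        tauto
    have hq : ∀ x, q x = x ∨ (q x ≠ a ∧ q x ∈ S ∧ y < q x ∧ x ≠ a ∧ x ∈ S ∧ y < x) := by
      intro x
      by_cases h : q x = x
      · exact Or.inl h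
      · have := (q3 x).1 h
        have h2 := (q3 (q x)).1 (by rw [q1]; exact Ne.symm h)
        tauto
    refine ⟨⟨fun x => ?_, fun x z hxz hz => ?_, fun x => ?_⟩, by simp⟩
    · have := p1 x
      have := q1 x
      have := hp x
      have := hq x
      simp only
      grind
    · have := hp x
      have := hq x
      have := hp z
      have := hq z
      have := p2 x z hxz
      have := q2 x z hxz
      have := hmin z
      have := hmin x
      simp only at hz ⊢
      grind
    · have := p3 x
      have := q3 x
      simp only
      grind
  · intro f hf
    rw [Finset.coe_filter, Set.mem_ofPred_eq, mem_noncrossingMatchings] at hf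
    obtain ⟨⟨h1, h2, h3⟩, h4⟩ := hf
    funext x
    have := h3 x
    have := h1 a
    simp only [Finset.mem_filter, Finset.mem_erase]
    grind
  · rintro ⟨p, q⟩ hpq
    rw [Finset.mem_coe, Finset.mem_product, mem_noncrossingMatchings,
      mem_noncrossingMatchings] at hpq
    obtain ⟨⟨p1, p2, p3⟩, q1, q2, q3⟩ := hpq
    simp only [Finset.mem_filter, Finset.mem_erase] at p1 p2 p3 q1 q2 q3
    refine Prod.ext (funext fun x => ?_) (funext fun x => ?_)
    · have := p3 x
      simp only [Finset.mem_filter, Finset.mem_erase]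
      grind
    · have := q3 x
      simp only [Finset.mem_filter, Finset.mem_erase]
      grind

-- Listing `S` in increasing order, its elements have `0, 1, 2, ...` predecessors. This turns a sum
-- over partners of the least element into a convolution.
omit [Fintype α] in
theorem Finset.sum_card_filter_lt (S : Finset α) (g : ℕ → ℕ) :
    ∑ y ∈ S, g (S.filter (· < y)).card = ∑ i ∈ Finset.range S.card, g i := by
  induction S using Finset.induction_on_max with
  | empty => simp
  | insert a S hS ih =>
    have ha : a ∉ S := fun h => lt_irrefl _ (hS a h)
    rw [Finset.sum_insert ha, Finset.card_insert_of_notMem ha, Finset.sum_range_succ, add_comm,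
      ← ih]
    congr 1
    · refine Finset.sum_congr rfl fun y hy => ?_
      rw [Finset.filter_insert, if_neg (hS y hy).not_gt]
    · rw [Finset.filter_insert, if_neg (lt_irrefl a), Finset.filter_true_of_mem hS]

/-- The number of noncrossing perfect matchings of `k` points on a line. -/
def matchingNumber (k : ℕ) : ℕ := if Even k then catalan (k / 2) else 0

theorem Finset.sum_range_two_mul_add_one (g : ℕ → ℕ) (j : ℕ) :
    ∑ i ∈ Finset.range (2 * j + 1), g i =
      ∑ i ∈ Finset.range (j + 1), g (2 * i) + ∑ i ∈ Finset.range j, g (2 * i + 1) := by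
  induction j with
  | zero => simp
  | succ j ih =>
    rw [show 2 * (j + 1) + 1 = 2 * j + 1 + 1 + 1 by ring, Finset.sum_range_succ,
      Finset.sum_range_succ, ih, Finset.sum_range_succ _ (j + 1), Finset.sum_range_succ _ j,
      Finset.sum_range_succ _ j]
    ring_nf

theorem matchingNumber_two_mul (k : ℕ) : matchingNumber (2 * k) = catalan k := by
  simp [matchingNumber]

theorem matchingNumber_odd {k : ℕ} (h : ¬ Even k) : matchingNumber k = 0 := by
  simp [matchingNumber, h]

/-- This is the Catalan recurrence padded by zeros at odd indices, so that the recursion over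
partners needs no parity condition. -/
theorem matchingNumber_succ (k : ℕ) : matchingNumber (k + 1) =
    ∑ i ∈ Finset.range k, matchingNumber i * matchingNumber (k - 1 - i) := by
  rcases Nat.even_or_odd' k with ⟨j, rfl | rfl⟩
  · rw [matchingNumber_odd (by simp [parity_simps])]
    refine (Finset.sum_eq_zero fun i hi => ?_).symm
    rw [Finset.mem_range] at hi
    by_cases he : Even i
    · rw [matchingNumber_odd (k := 2 * j - 1 - i), mul_zero]
      obtain ⟨r, rfl⟩ := he
      rw [Nat.even_iff]
      omega
    · rw [matchingNumber_odd he, zero_mul]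
  · rw [show 2 * j + 1 + 1 = 2 * (j + 1) by ring, matchingNumber_two_mul, catalan_succ,
      Finset.sum_range_two_mul_add_one, Finset.sum_eq_zero (s := Finset.range j), add_zero,
      Finset.sum_range]
    · refine Finset.sum_congr rfl fun i _ => ?_
      rw [show 2 * j + 1 - 1 - 2 * i.val = 2 * (j - i) by omega, matchingNumber_two_mul,
        matchingNumber_two_mul]
    · intro i _
      rw [matchingNumber_odd (by simp [parity_simps]), zero_mul]

theorem card_noncrossingMatchings (S : Finset α) :
    (noncrossingMatchings S).card = matchingNumber S.card := by
  induction hn : S.card using Nat.strong_induction_on generalizing S with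
  | _ n ih =>
    rcases S.eq_empty_or_nonempty with rfl | hne
    · rw [← hn, Finset.card_empty, show matchingNumber 0 = 1 by simp [matchingNumber],
        Finset.card_eq_one]
      refine ⟨id, Finset.ext fun f => ?_⟩
      rw [mem_noncrossingMatchings, Finset.mem_singleton]
      constructor
      · rintro ⟨_, _, h⟩
        funext x
        simpa using h x
      · rintro rfl
        exact ⟨fun _ => rfl, fun x y h1 h2 => absurd h1 (lt_asymm h2), by simp⟩
    · have ha := S.min'_mem hne
      set a := S.min' hne
      have hmin : ∀ z ∈ S, a ≤ z := fun z hz => S.min'_le z hz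
      have hcard := Finset.card_erase_add_one ha
      rw [Finset.card_eq_sum_card_fiberwise (f := fun f => f a) (t := S.erase a)]
      · rw [← hn, ← hcard, matchingNumber_succ, ← Finset.sum_card_filter_lt (S.erase a)
          (fun i => matchingNumber i * matchingNumber ((S.erase a).card - 1 - i))]
        refine Finset.sum_congr rfl fun y hy => ?_
        have hy' := Finset.mem_erase.1 hy
        have hsplit : ((S.erase a).filter (· < y)).card + ((S.erase a).filter (y < ·)).card + 1 =
            (S.erase a).card := by
          rw [← Finset.card_erase_add_one hy, ← Finset.card_union_of_disjoint]
          · congr 2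
            ext z
            simp only [Finset.mem_union, Finset.mem_filter, Finset.mem_erase]
            have := lt_trichotomy z y
            grind
          · rw [Finset.disjoint_left]
            intro z hz1 hz2
            exact lt_asymm (Finset.mem_filter.1 hz1).2 (Finset.mem_filter.1 hz2).2
        rw [card_noncrossingMatchings_fiber ha hmin hy'.2 hy'.1, ih _ (by omega) _ rfl,
          ih _ (by omega) _ rfl]
        congr 2
        omega
      · intro f hf
        rw [Finset.mem_coe, mem_noncrossingMatchings] at hf
        obtain ⟨h1, _, h3⟩ := hf
        rw [Finset.mem_coe, Finset.mem_erase, ← h3, h1]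
        exact ⟨(h3 a).2 ha, ((h3 a).2 ha).symm⟩

end NoncrossingCount

/-! ### The tour around a set of edges and spanning trees. -/

namespace RotationSystem

open Equiv Equiv.Perm

variable {D : Type} (M : RotationSystem D)

theorem edge_opp (d : D) : M.edge (M.opp d) = M.edge d :=
  Quotient.sound (sameCycle_apply_left.2 (SameCycle.refl _ _))

theorem origin_next (d : D) : M.origin (M.next d) = M.origin d :=
  Quotient.sound (sameCycle_apply_left.2 (SameCycle.refl _ _))

theorem edge_eq_edge_iff {d d' : D} : M.edge d = M.edge d' ↔ d' = d ∨ d' = M.opp d := by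
  constructor
  · intro h
    obtain ⟨n, hn⟩ : M.opp.SameCycle d d' := Quotient.exact h
    have h2 : M.opp ^ (2 : ℤ) = 1 := by
      ext z
      simp [zpow_ofNat, pow_two, M.opp_opp]
    rcases Int.even_or_odd' n with ⟨k, rfl | rfl⟩
    · rw [zpow_mul, h2, one_zpow] at hn
      exact Or.inl hn.symm
    · rw [zpow_add, zpow_mul, h2, one_zpow, one_mul, zpow_one] at hn
      exact Or.inr hn.symm
  · rintro (rfl | rfl)
    · rfl
    · exact (M.edge_opp d).symm

theorem edge_surjective : Function.Surjective M.edge := Quotient.mk_surjective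

theorem origin_surjective : Function.Surjective M.origin := Quotient.mk_surjective

instance [Finite D] : Finite M.Vertex := inferInstanceAs (Finite (Quotient _))

instance [Finite D] : Finite M.Edge := inferInstanceAs (Finite (Quotient _))

open Classical in
/-- The involution exchanging the two darts of every edge in `T`, and fixing all other darts. -/
noncomputable def flip (T : Set M.Edge) : Perm D :=
  Function.Involutive.toPerm (fun d => if M.edge d ∈ T then M.opp d else d) fun d => by
    by_cases h : M.edge d ∈ T
    · simp [h, M.edge_opp, M.opp_opp]
    · simp [h]

variable {M}

theorem flip_of_mem {T : Set M.Edge} {d : D} (h : M.edge d ∈ T) : M.flip T d = M.opp d :=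
  if_pos h

theorem flip_of_notMem {T : Set M.Edge} {d : D} (h : M.edge d ∉ T) : M.flip T d = d :=
  if_neg h

theorem flip_flip (T : Set M.Edge) : Function.Involutive (M.flip T) := fun d =>
  (M.flip T).left_inv d

theorem flip_mul_self (T : Set M.Edge) : M.flip T * M.flip T = 1 :=
  Equiv.ext (flip_flip T)

theorem flip_apply_ne_iff {T : Set M.Edge} {d : D} : M.flip T d ≠ d ↔ M.edge d ∈ T := by
  by_cases h : M.edge d ∈ T
  · simp [flip_of_mem h, h, M.opp_ne]
  · simp [flip_of_notMem h, h]

theorem flip_mul_flip_compl (T : Set M.Edge) : M.flip T * M.flip Tᶜ = M.opp := by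
  ext d
  rw [Perm.mul_apply]
  by_cases h : M.edge d ∈ T
  · rw [flip_of_notMem (T := Tᶜ) (by simpa using h), flip_of_mem h]
  · rw [flip_of_mem (T := Tᶜ) h, flip_of_notMem (by rwa [M.edge_opp])]

theorem flip_empty : M.flip ∅ = 1 := Equiv.ext fun _ => flip_of_notMem (by simp)

theorem flip_insert_edge [DecidableEq D] {T : Set M.Edge} {d : D} (h : M.edge d ∉ T) :
    M.flip (insert (M.edge d) T) = M.flip T * swap d (M.opp d) := by
  ext x
  rw [Perm.mul_apply]
  rcases eq_or_ne x d with rfl | hx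
  · rw [swap_apply_left, flip_of_mem (Set.mem_insert _ _), flip_of_notMem]
    rwa [M.edge_opp]
  rcases eq_or_ne x (M.opp d) with rfl | hx'
  · rw [swap_apply_right, flip_of_mem, flip_of_notMem h, M.opp_opp]
    rw [M.edge_opp]
    exact Set.mem_insert _ _
  rw [swap_apply_of_ne_of_ne hx hx']
  have hne : M.edge x ≠ M.edge d := fun hxd => by
    rcases M.edge_eq_edge_iff.1 hxd.symm with h | h
    · exact hx h
    · exact hx' h
  by_cases hT : M.edge x ∈ T
  · rw [flip_of_mem hT, flip_of_mem (Set.mem_insert_of_mem _ hT)]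
  · rw [flip_of_notMem hT, flip_of_notMem (by simp [hne, hT])]

theorem card_support_flip [Fintype D] [DecidableEq D] (T : Set M.Edge) :
    (M.flip T).support.card = 2 * T.ncard := by
  classical
  have := Fintype.ofFinite M.Edge
  rw [Set.ncard_eq_toFinset_card', Finset.card_eq_sum_card_fiberwise (f := M.edge)
    (t := T.toFinset), Finset.sum_const_nat (m := 2), mul_comm]
  · intro e he
    rw [Set.mem_toFinset] at he
    obtain ⟨d, rfl⟩ := M.edge_surjective e
    rw [Finset.card_eq_two]
    refine ⟨d, M.opp d, (M.opp_ne d).symm, Finset.ext fun x => ?_⟩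
    simp only [Finset.mem_filter, mem_support, flip_apply_ne_iff, Finset.mem_insert,
      Finset.mem_singleton, eq_comm (b := M.edge d), edge_eq_edge_iff]
    constructor
    · exact fun h => h.2
    · rintro (rfl | rfl)
      · exact ⟨he, Or.inl rfl⟩
      · exact ⟨by rwa [M.edge_opp], Or.inr rfl⟩
  · intro x hx
    simpa [flip_apply_ne_iff] using hx

theorem card_darts [Fintype D] : Fintype.card D = 2 * Nat.card M.Edge := by
  classical
  rw [← Set.ncard_univ, ← card_support_flip, ← Finset.card_univ]
  congr 1
  ext d
  simp [flip_apply_ne_iff]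

variable (M) in
/-- The tour around the edges in `T`: it walks along the darts whose edge is in `T` and crosses
the other ones. -/
noncomputable def tour (T : Set M.Edge) : Perm D := M.next * M.flip T

theorem tour_mul_flip (T : Set M.Edge) : M.tour T * M.flip T = M.next := by
  rw [tour, mul_assoc, flip_mul_self, mul_one]

/-- Faces are thus obtained from the tour and the non-tree edges exactly as `tour_mul_flip` obtains
vertices from the tour and the tree edges. -/
theorem tour_mul_flip_compl (T : Set M.Edge) : M.tour T * M.flip Tᶜ = M.next * M.opp := by
  rw [tour, mul_assoc, flip_mul_flip_compl]

/-- One step of the tour first moves along an edge of `T` or stays in place, and then turns around a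
vertex. -/
theorem reachable_of_sameCycle_tour [Finite D] {T : Set M.Edge} {d d' : D}
    (h : (M.tour T).SameCycle d d') : (M.subgraphOf T).Reachable (M.origin d) (M.origin d') := by
  refine h.mem_of_forall_apply_mem
    (A := {x | (M.subgraphOf T).Reachable (M.origin d) (M.origin x)})
    (fun x hx => SimpleGraph.Reachable.trans hx ?_) (SimpleGraph.Reachable.refl _)
  rw [tour, Perm.mul_apply, origin_next]
  by_cases hT : M.edge x ∈ T
  · rw [flip_of_mem hT]
    by_cases ho : M.origin x = M.origin (M.opp x)
    · rw [ho]
    · exact SimpleGraph.Adj.reachable ⟨ho, x, hT, rfl, rfl⟩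
  · rw [flip_of_notMem hT]

/-- For `A = ∅` the tour is `next`, whose cycles are the vertices. Every added edge is a bridge of
the tree, so its two darts lie in different cycles of the current tour, and these cycles merge. -/
theorem IsSpanningTree.numCycles_tour_add_ncard [Finite D] {T A : Set M.Edge}
    (hT : M.IsSpanningTree T) (hA : A ⊆ T) :
    numCycles (M.tour A) + A.ncard = Nat.card M.Vertex := by
  classical
  induction A, (Set.toFinite A) using Set.Finite.induction_on with
  | empty =>
    rw [tour, flip_empty, mul_one, Set.ncard_empty]
    rfl
  | @insert e A he _ ih =>
    obtain ⟨d, rfl⟩ := M.edge_surjective e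
    have hdT : M.edge d ∈ T := hA (Set.mem_insert _ _)
    rw [Set.ncard_insert_of_notMem he, ← ih ((Set.subset_insert _ _).trans hA), tour,
      flip_insert_edge he, ← mul_assoc, ← numCycles_mul_swap_of_not_sameCycle (x := d)
      (y := M.opp d) (π := M.tour A)]
    · rw [tour]
      ring
    · intro hs
      have hadj : (M.subgraphOf T).Adj (M.origin d) (M.origin (M.opp d)) :=
        ⟨hT.1 d hdT, d, hdT, rfl, rfl⟩
      have hb := SimpleGraph.isAcyclic_iff_forall_adj_isBridge.1 hT.2.2.isAcyclic hadj
      rw [SimpleGraph.isBridge_iff] at hb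
      refine hb ((reachable_of_sameCycle_tour hs).mono ?_)
      rintro u v ⟨huv, x, hx, rfl, rfl⟩
      have hxT : M.edge x ∈ T := hA (Set.mem_insert_of_mem _ hx)
      rw [SimpleGraph.deleteEdges_adj]
      -- An edge of `A` with the same ends as `d` would be parallel to it in `T`, hence equal to it,
      -- contrary to `he`.
      refine ⟨⟨huv, x, hxT, rfl, rfl⟩, ?_⟩
      intro hmem
      rw [Set.mem_singleton_iff, Sym2.eq_iff] at hmem
      rcases hmem with ⟨h1, h2⟩ | ⟨h1, h2⟩
      · rw [hT.2.1 x d hxT hdT h1 h2] at hx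
        exact he hx
      · have := hT.2.1 x (M.opp d) hxT (by rwa [M.edge_opp]) h1 (by rwa [M.opp_opp])
        rw [this, M.edge_opp] at hx
        exact he hx

/-- The exclusion of loops and multiple edges puts `T` in bijection with the edges of the simple
graph, where the usual formula for trees applies. -/
theorem IsSpanningTree.ncard_add_one [Finite D] {T : Set M.Edge}
    (hT : M.IsSpanningTree T) : T.ncard + 1 = Nat.card M.Vertex := by
  have h1 := (SimpleGraph.isTree_iff_connected_and_card.1 hT.2.2).2
  rw [← h1]
  congr 1
  rw [Nat.card_coe_set_eq]
  choose r hr using M.edge_surjective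
  refine Set.ncard_congr (fun e _ => s(M.origin (r e), M.origin (M.opp (r e)))) ?_ ?_ ?_
  · intro e he
    rw [← hr e] at he
    exact ⟨hT.1 _ he, r e, he, rfl, rfl⟩
  · intro e e' he he' h
    rw [← hr e] at he ⊢
    rw [← hr e'] at he' ⊢
    rw [Sym2.eq_iff] at h
    rcases h with ⟨h1, h2⟩ | ⟨h1, h2⟩
    · rw [hT.2.1 _ _ he he' h1 h2]
    · rw [hT.2.1 _ (M.opp (r e')) he (by rwa [M.edge_opp]) h1 (by rwa [M.opp_opp]), M.edge_opp]
  · intro p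
    induction p using Sym2.ind with | h u v => ?_
    rintro ⟨_, d, hd, rfl, rfl⟩
    refine ⟨M.edge d, hd, ?_⟩
    rcases M.edge_eq_edge_iff.1 (hr (M.edge d)).symm with h | h
    · rw [h]
    · rw [h, M.opp_opp, Sym2.eq_swap]

theorem IsSpanningTree.numCycles_tour [Finite D] {T : Set M.Edge}
    (hT : M.IsSpanningTree T) : numCycles (M.tour T) = 1 := by
  have h1 := hT.numCycles_tour_add_ncard subset_rfl
  have h2 := hT.ncard_add_one
  omega

theorem ncard_add_ncard_compl [Finite D] (T : Set M.Edge) :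
    T.ncard + Tᶜ.ncard = Nat.card M.Edge := Set.ncard_add_ncard_compl T

theorem IsPlanar.card_face [Finite D] {T : Set M.Edge} (hM : M.IsPlanar)
    (hT : M.IsSpanningTree T) : Nat.card M.Face = Tᶜ.ncard + 1 := by
  have h1 := hM.2
  have h2 := hT.ncard_add_one
  have h3 := ncard_add_ncard_compl T
  omega

theorem sameCycle_of_numCycles_eq_one {α : Type*} {π : Perm α} (h : numCycles π = 1)
    (x y : α) : π.SameCycle x y := by
  rw [numCycles, Nat.card_eq_one_iff_unique] at h
  exact Quotient.exact (h.1.elim (Quotient.mk _ x) (Quotient.mk _ y))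

/-- Each step of the tour applies `next` or `next * opp`, depending on the dart; the tour itself
need not belong to the group they generate. -/
theorem isConnected_of_numCycles_tour [Finite D] {T : Set M.Edge}
    (h : numCycles (M.tour T) = 1) : M.IsConnected := by
  intro d d'
  refine (sameCycle_of_numCycles_eq_one h d d').mem_of_forall_apply_mem
    (A := {x | ∃ g ∈ Subgroup.closure {M.next, M.opp}, g d = x}) ?_ ⟨1, Subgroup.one_mem _, rfl⟩
  rintro x ⟨g, hg, rfl⟩
  have hn : M.next ∈ Subgroup.closure {M.next, M.opp} := Subgroup.subset_closure (by simp)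
  have ho : M.opp ∈ Subgroup.closure {M.next, M.opp} := Subgroup.subset_closure (by simp)
  rw [tour, Perm.mul_apply]
  by_cases hT : M.edge (g d) ∈ T
  · rw [flip_of_mem hT]
    exact ⟨M.next * M.opp * g, mul_mem (mul_mem hn ho) hg, rfl⟩
  · rw [flip_of_notMem hT]
    exact ⟨M.next * g, mul_mem hn hg, rfl⟩

/-- The tour makes the graph connected, so on `T.ncard + 1` vertices it has at least `T.ncard`
edges, all images of elements of `T`. Equality is forced: the map from `T` to edges is injective,
which excludes multiple edges, and its values are genuine edges, which excludes loops. -/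
theorem isSpanningTree_of_numCycles_tour [Finite D] {T : Set M.Edge}
    (h : numCycles (M.tour T) = 1) (hV : Nat.card M.Vertex = T.ncard + 1) :
    M.IsSpanningTree T := by
  have hne : Nonempty M.Vertex := by
    rw [← Finite.card_pos_iff, hV]
    exact Nat.succ_pos _
  have hconn : (M.subgraphOf T).Connected := by
    rw [SimpleGraph.connected_iff]
    refine ⟨fun u v => ?_, hne⟩
    obtain ⟨d, rfl⟩ := M.origin_surjective u
    obtain ⟨d', rfl⟩ := M.origin_surjective v
    exact reachable_of_sameCycle_tour (sameCycle_of_numCycles_eq_one h d d')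
  choose r hr using M.edge_surjective
  set φ : M.Edge → Sym2 M.Vertex := fun e => s(M.origin (r e), M.origin (M.opp (r e))) with hφ
  have hφe : ∀ d, φ (M.edge d) = s(M.origin d, M.origin (M.opp d)) := by
    intro d
    simp only [hφ]
    rcases M.edge_eq_edge_iff.1 (hr (M.edge d)).symm with h | h
    · rw [h]
    · rw [h, M.opp_opp, Sym2.eq_swap]
  have hsub : (M.subgraphOf T).edgeSet ⊆ φ '' T := by
    intro p
    induction p using Sym2.ind with | h u v => ?_
    rintro ⟨_, d, hd, rfl, rfl⟩
    exact ⟨M.edge d, hd, hφe d⟩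
  have h1 := hconn.card_vert_le_card_edgeSet_add_one
  rw [Nat.card_coe_set_eq] at h1
  have h2 : (φ '' T).ncard ≤ T.ncard := Set.ncard_image_le (Set.toFinite T)
  have h3 : (M.subgraphOf T).edgeSet.ncard ≤ (φ '' T).ncard :=
    Set.ncard_le_ncard hsub (Set.toFinite _)
  have heq : (M.subgraphOf T).edgeSet = φ '' T :=
    Set.eq_of_subset_of_ncard_le hsub (by omega) (Set.toFinite _)
  have hinj : Set.InjOn φ T := Set.injOn_of_ncard_image_eq (by omega) (Set.toFinite _)
  have hloop : ∀ d, M.edge d ∈ T → M.origin d ≠ M.origin (M.opp d) := by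
    intro d hd
    have : φ (M.edge d) ∈ (M.subgraphOf T).edgeSet := heq ▸ ⟨_, hd, rfl⟩
    rw [hφe] at this
    exact ((SimpleGraph.mem_edgeSet _).1 this).ne
  refine ⟨hloop, fun d d' hd hd' ho ho' => ?_, ?_⟩
  · have : M.edge d = M.edge d' := hinj hd hd' (by rw [hφe, hφe, ho, ho'])
    rcases M.edge_eq_edge_iff.1 this with h | h
    · exact h.symm
    · rw [h] at ho
      exact absurd ho (hloop d hd)
  · rw [SimpleGraph.isTree_iff_connected_and_card, Nat.card_coe_set_eq]
    exact ⟨hconn, by omega⟩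

theorem isPlanar_of_numCycles_tour [Finite D] {T : Set M.Edge}
    (h : numCycles (M.tour T) = 1) (hV : Nat.card M.Vertex = T.ncard + 1)
    (hF : Nat.card M.Face = Tᶜ.ncard + 1) : M.IsPlanar := by
  refine ⟨isConnected_of_numCycles_tour h, ?_⟩
  have := ncard_add_ncard_compl T
  omega

end RotationSystem

/-! ### Coding tree-rooted maps by pairs of noncrossing matchings. -/

section TourCode

open Equiv Equiv.Perm RotationSystem

theorem Fin.eq_of_apply_add_one {D : Type*} {m : ℕ} [NeZero m] {f g : Fin m → D} (τ : D → D)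
    (hf : ∀ z, f (z + 1) = τ (f z)) (hg : ∀ z, g (z + 1) = τ (g z)) (h0 : f 0 = g 0) : f = g := by
  have key : ∀ k (hk : k < m), f ⟨k, hk⟩ = g ⟨k, hk⟩ := by
    intro k
    induction k with
    | zero => exact fun _ => h0
    | succ k ih =>
      intro hk
      have hlt : (⟨k, by omega⟩ : Fin m) < ⟨k + 1, hk⟩ := Fin.lt_def.2 (by simp)
      have : (⟨k + 1, hk⟩ : Fin m) = ⟨k, by omega⟩ + 1 :=
        Fin.ext (Fin.val_add_one_of_lt_of hlt).symm
      rw [this, hf, hg, ih]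
  exact funext fun z => key z.val z.isLt

/-- A permutation with a single cycle is conjugate to the rotation of `Fin m`. -/
theorem exists_equiv_fin_of_numCycles_eq_one {D : Type*} [Finite D] {π : Perm D} {m : ℕ} [NeZero m]
    (h : numCycles π = 1) (hm : Nat.card D = m) (r : D) :
    ∃ e : Fin m ≃ D, (∀ z, e (z + 1) = π (e z)) ∧ e 0 = r := by
  have hsurj : ∀ d, ∃ k : ℕ, (π ^ k) r = d := fun d =>
    (sameCycle_of_numCycles_eq_one h r d).exists_nat_pow_eq
  -- If the orbit of `r` closes after `k` steps, those `k` points already exhaust `D`.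
  have hreturn : ∀ k, 0 < k → (π ^ k) r = r → m ≤ k := by
    intro k hk hkr
    have hmul : ∀ q : ℕ, (π ^ (k * q)) r = r := by
      intro q
      induction q with
      | zero => simp
      | succ q ih => rw [Nat.mul_succ, pow_add, Perm.mul_apply, hkr, ih]
    have : Function.Surjective (fun i : Fin k => (π ^ i.val) r) := by
      intro d
      obtain ⟨j, rfl⟩ := hsurj d
      refine ⟨⟨j % k, Nat.mod_lt _ hk⟩, ?_⟩
      conv_rhs => rw [← Nat.mod_add_div j k, pow_add, Perm.mul_apply, hmul]
    have := Nat.card_le_card_of_surjective _ this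
    rwa [hm, Nat.card_eq_fintype_card, Fintype.card_fin] at this
  have hinj : Function.Injective (fun i : Fin m => (π ^ i.val) r) := by
    intro i j hij
    simp only at hij
    wlog hle : i ≤ j generalizing i j
    · exact (this hij.symm (le_of_not_ge hle)).symm
    by_contra hne
    have hlt : i.val < j.val := lt_of_le_of_ne hle fun h => hne (Fin.ext h)
    have h1 : (π ^ (j.val - i.val)) r = r := by
      apply (π ^ i.val).injective
      rw [← Perm.mul_apply, ← pow_add, hij]
      congr 2
      omega
    have := hreturn _ (by omega) h1
    omega
  have hbij : Function.Bijective (fun i : Fin m => (π ^ i.val) r) :=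
    (Nat.bijective_iff_injective_and_card _).2 ⟨hinj, by simp [hm]⟩
  -- The point `π ^ m r` equals some `π ^ i r` with `i < m`, and `i > 0` would be a return after
  -- fewer than `m` steps. This handles the wrap-around of `Fin m`.
  have hper : (π ^ m) r = r := by
    obtain ⟨i, hi⟩ := hbij.2 ((π ^ m) r)
    simp only at hi
    rcases Nat.eq_zero_or_pos i.val with h0 | hpos
    · rw [← hi, h0, pow_zero, Perm.one_apply]
    · have h1 : (π ^ (m - i.val)) r = r := by
        apply (π ^ i.val).injective
        rw [← Perm.mul_apply, ← pow_add, hi]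
        congr 2
        omega
      have := hreturn _ (by omega) h1
      omega
  refine ⟨Equiv.ofBijective _ hbij, fun z => ?_, ?_⟩
  · simp only [Equiv.ofBijective_apply]
    rw [← Perm.mul_apply, ← pow_succ']
    by_cases hz : z.val + 1 < m
    · have hlt : z < ⟨z.val + 1, hz⟩ := Fin.lt_def.2 (by simp)
      rw [Fin.val_add_one_of_lt_of hlt]
    · have h1 : z.val + 1 = m := by omega
      have h2 : (z + 1).val = 0 := by
        rw [Fin.val_add, Fin.val_one', Nat.add_mod_mod, h1, Nat.mod_self]
      rw [h1, h2, hper, pow_zero, Perm.one_apply]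
  · simp

/-- The codes of tree-rooted maps with `m` darts: a set `S` of steps of the tour around the tree,
a noncrossing matching of `S` (the edges of the tree) and a noncrossing matching of the other
steps. -/
noncomputable def tourCodes (m : ℕ) :
    Finset (Σ _ : Finset (Fin m), (Fin m → Fin m) × (Fin m → Fin m)) :=
  Finset.univ.sigma fun S => noncrossingMatchings S ×ˢ noncrossingMatchings Sᶜ

theorem mem_tourCodes {m : ℕ} {S : Finset (Fin m)} {f g : Fin m → Fin m} :
    ⟨S, f, g⟩ ∈ tourCodes m ↔
      (Function.Involutive f ∧ IsNoncrossing f ∧ ∀ x, f x ≠ x ↔ x ∈ S) ∧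
      (Function.Involutive g ∧ IsNoncrossing g ∧ ∀ x, g x ≠ x ↔ x ∉ S) := by
  simp [tourCodes, mem_noncrossingMatchings]

namespace RotationSystem

/-- The map whose tour is `τ`, with tree edges given by the involution `ι` and the other edges
by the involution `κ`. -/
def ofTour {D : Type} (τ ι κ : Perm D) (hι : Function.Involutive ι) (hκ : Function.Involutive κ)
    (h : ∀ d, κ d ≠ d ↔ ι d = d) : RotationSystem D where
  next := τ * ι
  opp := ι * κ
  opp_opp d := by
    have := hι d
    have := hκ d
    have := h d
    have := h (ι d)
    have := h (κ d)
    simp only [Perm.mul_apply]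
    by_cases hd : ι d = d <;> grind
  opp_ne d := by
    have := hι d
    have := hκ d
    have := h d
    have := h (κ d)
    simp only [Perm.mul_apply]
    by_cases hd : ι d = d <;> grind

section ofTour

variable {D : Type} (τ ι κ : Perm D) (hι : Function.Involutive ι) (hκ : Function.Involutive κ)
    (h : ∀ d, κ d ≠ d ↔ ι d = d)

/-- The tree edges of `ofTour`. -/
def ofTourTree : Set (ofTour τ ι κ hι hκ h).Edge :=
  (ofTour τ ι κ hι hκ h).edge '' {d | ι d ≠ d}

theorem edge_mem_ofTourTree {d : D} :
    (ofTour τ ι κ hι hκ h).edge d ∈ ofTourTree τ ι κ hι hκ h ↔ ι d ≠ d := by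
  constructor
  · rintro ⟨d', hd', he⟩
    rcases (edge_eq_edge_iff _).1 he with rfl | rfl
    · exact hd'
    · have h1 : κ d' = d' := not_not.1 fun hk => hd' ((h d').1 hk)
      change ι (ι (κ d')) ≠ ι (κ d')
      rw [h1, hι]
      exact Ne.symm hd'
  · exact fun hd => ⟨d, hd, rfl⟩

theorem flip_ofTourTree : (ofTour τ ι κ hι hκ h).flip (ofTourTree τ ι κ hι hκ h) = ι := by
  ext d
  by_cases hd : ι d = d
  · rw [flip_of_notMem (by rw [edge_mem_ofTourTree]; simpa using hd), hd]
  · rw [flip_of_mem ((edge_mem_ofTourTree ..).2 hd)]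
    have h1 : κ d = d := not_not.1 fun hk => hd ((h d).1 hk)
    change ι (κ d) = ι d
    rw [h1]

theorem flip_compl_ofTourTree :
    (ofTour τ ι κ hι hκ h).flip (ofTourTree τ ι κ hι hκ h)ᶜ = κ := by
  have h1 := flip_mul_flip_compl (ofTourTree τ ι κ hι hκ h)
  rw [flip_ofTourTree] at h1
  exact mul_left_cancel h1

theorem tour_ofTourTree : (ofTour τ ι κ hι hκ h).tour (ofTourTree τ ι κ hι hκ h) = τ := by
  rw [tour, flip_ofTourTree]
  change τ * ι * ι = τ
  rw [mul_assoc, show ι * ι = 1 from Equiv.ext hι, mul_one]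

end ofTour

end RotationSystem

namespace TreeRootedMap

variable {m : ℕ} [NeZero m]

section ofCode

variable {S : Finset (Fin m)} {f g : Fin m → Fin m} (hc : ⟨S, f, g⟩ ∈ tourCodes m)

/-- The rotation system with a given code. -/
abbrev codeSystem : RotationSystem (Fin m) :=
  ofTour (Equiv.addRight 1) ((mem_tourCodes.1 hc).1.1.toPerm) ((mem_tourCodes.1 hc).2.1.toPerm)
    (mem_tourCodes.1 hc).1.1 (mem_tourCodes.1 hc).2.1 fun d => by
      rw [Function.Involutive.coe_toPerm, Function.Involutive.coe_toPerm,
        (mem_tourCodes.1 hc).2.2.2, ← (mem_tourCodes.1 hc).1.2.2, not_not]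

/-- The spanning tree with a given code. -/
abbrev codeTree : Set (codeSystem hc).Edge := ofTourTree _ _ _ _ _ _

theorem edge_mem_codeTree {d : Fin m} : (codeSystem hc).edge d ∈ codeTree hc ↔ d ∈ S := by
  rw [← (mem_tourCodes.1 hc).1.2.2]
  exact edge_mem_ofTourTree ..

theorem flip_codeTree (d : Fin m) : (codeSystem hc).flip (codeTree hc) d = f d :=
  congrArg (fun π : Perm (Fin m) => π d) (flip_ofTourTree ..)

theorem flip_compl_codeTree (d : Fin m) : (codeSystem hc).flip (codeTree hc)ᶜ d = g d :=
  congrArg (fun π : Perm (Fin m) => π d) (flip_compl_ofTourTree ..)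

theorem tour_codeTree : (codeSystem hc).tour (codeTree hc) = Equiv.addRight 1 :=
  tour_ofTourTree ..

theorem numCycles_tour_codeTree : numCycles ((codeSystem hc).tour (codeTree hc)) = 1 := by
  rw [tour_codeTree, Fin.numCycles_addRight_one]

theorem two_mul_ncard_codeTree : 2 * (codeTree hc).ncard = S.card := by
  rw [← card_support_flip]
  congr 1
  ext d
  rw [mem_support, flip_apply_ne_iff, edge_mem_codeTree]

/-- The vertices are the cycles of the rotation times `f`, so this is the cycle count of a
noncrossing involution; the face count is the same with `g`. -/
theorem card_vertex_codeSystem :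
    Nat.card (codeSystem hc).Vertex = (codeTree hc).ncard + 1 := by
  have h1 := Fin.two_mul_numCycles_of_isNoncrossing ((codeSystem hc).flip (codeTree hc))
    (flip_flip _) (by
      rw [show ⇑((codeSystem hc).flip (codeTree hc)) = f from funext (flip_codeTree hc)]
      exact (mem_tourCodes.1 hc).1.2.1)
  rw [card_support_flip, ← tour_codeTree hc, tour_mul_flip] at h1
  change numCycles (codeSystem hc).next = _
  omega

theorem card_face_codeSystem :
    Nat.card (codeSystem hc).Face = (codeTree hc)ᶜ.ncard + 1 := by
  have h1 := Fin.two_mul_numCycles_of_isNoncrossing ((codeSystem hc).flip (codeTree hc)ᶜ)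
    (flip_flip _) (by
      rw [show ⇑((codeSystem hc).flip (codeTree hc)ᶜ) = g from funext (flip_compl_codeTree hc)]
      exact (mem_tourCodes.1 hc).2.2.1)
  rw [card_support_flip, ← tour_codeTree hc, tour_mul_flip_compl] at h1
  change numCycles ((codeSystem hc).next * (codeSystem hc).opp) = _
  omega

/-- The tree-rooted map with a given code. -/
def ofCode : TreeRootedMap :=
  ofDarts (Fin m) inferInstance (codeSystem hc)
    (isPlanar_of_numCycles_tour (numCycles_tour_codeTree hc) (card_vertex_codeSystem hc)
      (card_face_codeSystem hc)) 0 (codeTree hc)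
    (isSpanningTree_of_numCycles_tour (numCycles_tour_codeTree hc) (card_vertex_codeSystem hc))

theorem two_mul_numEdges_ofCode : 2 * (ofCode hc).numEdges = m := by
  have := card_darts (M := codeSystem hc)
  rw [Fintype.card_fin] at this
  exact this.symm

theorem two_mul_numVertices_ofCode : 2 * (ofCode hc).numVertices = S.card + 2 := by
  have := card_vertex_codeSystem hc
  have h2 := two_mul_ncard_codeTree hc
  change 2 * Nat.card (codeSystem hc).Vertex = _
  omega

end ofCode

theorem numVertices_add_numFaces : ∀ X : TreeRootedMap,
    X.numVertices + X.numFaces = X.numEdges + 2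
  | atomic => rfl
  | ofDarts _ _ _ planar _ _ _ => planar.2

theorem flip_equivariant {D D' : Type} {M : RotationSystem D} {M' : RotationSystem D'} (e : D ≃ D')
    {T : Set M.Edge} {T' : Set M'.Edge} (ho : ∀ d, e (M.opp d) = M'.opp (e d))
    (hT : ∀ d, M.edge d ∈ T ↔ M'.edge (e d) ∈ T') (d : D) :
    e (M.flip T d) = M'.flip T' (e d) := by
  by_cases h : M.edge d ∈ T
  · rw [flip_of_mem h, flip_of_mem ((hT d).1 h), ho]
  · rw [flip_of_notMem h, flip_of_notMem (mt (hT d).2 h)]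

/-- Rooted maps are rigid: an isomorphism commutes with the tour, which is the rotation on both
sides, and fixes the root `0`, so it is the identity. -/
theorem eq_of_iso_ofCode {S S' : Finset (Fin m)} {f g f' g' : Fin m → Fin m}
    (hc : ⟨S, f, g⟩ ∈ tourCodes m) (hc' : ⟨S', f', g'⟩ ∈ tourCodes m)
    (h : Iso (ofCode hc) (ofCode hc')) : S = S' ∧ f = f' ∧ g = g' := by
  obtain ⟨e, hn, ho, hr, hT⟩ := h
  have hflip := flip_equivariant e ho hT
  have htour : ∀ z, e (z + 1) = e z + 1 := by
    intro z
    have h1 : (codeSystem hc).tour (codeTree hc) z = z + 1 := by rw [tour_codeTree]; rfl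
    have h2 : (codeSystem hc').tour (codeTree hc') (e z) = e z + 1 := by rw [tour_codeTree]; rfl
    rw [← h1, ← h2, tour, tour, Perm.mul_apply, Perm.mul_apply, hn, hflip]
  have he : ⇑e = id := Fin.eq_of_apply_add_one (· + 1) htour (fun _ => rfl) hr
  simp only [he, id] at hT hflip ho
  have hTc : ∀ d, (codeSystem hc).edge d ∈ (codeTree hc)ᶜ ↔
      (codeSystem hc').edge d ∈ (codeTree hc')ᶜ := fun d => not_congr (hT d)
  refine ⟨Finset.ext fun d => ?_, funext fun d => ?_, funext fun d => ?_⟩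
  · rw [← edge_mem_codeTree hc, ← edge_mem_codeTree hc', hT]
  · rw [← flip_codeTree hc, ← flip_codeTree hc', hflip]
  · rw [← flip_compl_codeTree hc, ← flip_compl_codeTree hc']
    exact flip_equivariant (Equiv.refl _) ho hTc d

theorem exists_iso_ofCode (X : TreeRootedMap) (hX : 2 * X.numEdges = m) :
    ∃ (S : Finset (Fin m)) (f g : Fin m → Fin m) (hc : ⟨S, f, g⟩ ∈ tourCodes m),
      Iso (ofCode hc) X := by
  classical
  have hm := NeZero.pos m
  rcases X with _ | ⟨D, finite, M, planar, root, T, tree⟩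
  · change 2 * 0 = m at hX
    omega
  have := Fintype.ofFinite D
  have hcard : Nat.card D = m := by
    rw [Nat.card_eq_fintype_card, card_darts (M := M)]
    exact hX
  obtain ⟨e, he, h0⟩ := exists_equiv_fin_of_numCycles_eq_one tree.numCycles_tour hcard root
  -- The relations `|V| = |T| + 1` and `|F| = |Tᶜ| + 1` say that both involutions reach the maximal
  -- cycle count, which forces them to be noncrossing once transported to `Fin m`.
  have hperm : ∀ A : Set M.Edge,
      numCycles (M.tour T * M.flip A) = A.ncard + 1 →
      Function.Involutive (e.symm.permCongr (M.flip A)) ∧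
      IsNoncrossing (e.symm.permCongr (M.flip A)) ∧
        ∀ x, e.symm.permCongr (M.flip A) x ≠ x ↔ M.edge (e x) ∈ A := by
    intro A hA
    have hinv : Function.Involutive (e.symm.permCongr (M.flip A)) := fun x => by
      simp [Equiv.permCongr_apply, flip_flip A _]
    have hsupp : ∀ x, e.symm.permCongr (M.flip A) x ≠ x ↔ M.edge (e x) ∈ A := fun x => by
      rw [← flip_apply_ne_iff, Equiv.permCongr_apply, Equiv.symm_symm, Ne, Equiv.symm_apply_eq]
    refine ⟨hinv, Fin.isNoncrossing_of_two_mul_numCycles _ hinv ?_, hsupp⟩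
    rw [numCycles_conj (Equiv.addRight (1 : Fin m) * e.symm.permCongr (M.flip A))
      (M.tour T * M.flip A) e (fun x => ?_), hA]
    · have : (e.symm.permCongr (M.flip A)).support.card = (M.flip A).support.card := by
        refine Finset.card_equiv e fun x => ?_
        rw [mem_support, mem_support, hsupp, flip_apply_ne_iff]
      rw [this, card_support_flip]
      ring
    · rw [Perm.mul_apply, Perm.mul_apply, Equiv.coe_addRight, he, Equiv.permCongr_apply,
        Equiv.symm_symm, Equiv.apply_symm_apply]
  have h1 := hperm T (by rw [tour_mul_flip, tree.ncard_add_one]; rfl)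
  have h2 := hperm Tᶜ (by
    rw [tour_mul_flip_compl, ← planar.card_face tree]; rfl)
  have hc : (⟨Finset.univ.filter fun x => M.edge (e x) ∈ T, e.symm.permCongr (M.flip T),
      e.symm.permCongr (M.flip Tᶜ)⟩ : Σ _ : Finset (Fin m), (Fin m → Fin m) × (Fin m → Fin m)) ∈
      tourCodes m := by
    rw [mem_tourCodes]
    refine ⟨⟨h1.1, h1.2.1, fun x => ?_⟩, h2.1, h2.2.1, fun x => ?_⟩
    · rw [h1.2.2]; simp
    · rw [h2.2.2]; simp
  have hf : ∀ d, e ((codeSystem hc).flip (codeTree hc) d) = M.flip T (e d) := fun d => by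
    rw [flip_codeTree, Equiv.permCongr_apply, Equiv.symm_symm, Equiv.apply_symm_apply]
  have hg : ∀ d, e ((codeSystem hc).flip (codeTree hc)ᶜ d) = M.flip Tᶜ (e d) := fun d => by
    rw [flip_compl_codeTree, Equiv.permCongr_apply, Equiv.symm_symm, Equiv.apply_symm_apply]
  refine ⟨_, _, _, hc, e, fun d => ?_, fun d => ?_, h0, fun d => ?_⟩
  · rw [← tour_mul_flip (codeTree hc), ← tour_mul_flip T, Perm.mul_apply, Perm.mul_apply,
      tour_codeTree, Equiv.coe_addRight, he, hf]
  · rw [← flip_mul_flip_compl (codeTree hc), ← flip_mul_flip_compl T, Perm.mul_apply,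
      Perm.mul_apply, hf, hg]
  · rw [edge_mem_codeTree]
    simp

end TreeRootedMap

end TourCode

/-! ### A module criterion for linear differential equations. -/

section DFinite

open MvPowerSeries

variable {σ K : Type*} [Field K]

/-- By Leibniz, `q ∂(p v) = p (q ∂v) + (q ∂p) v`, so stability need only be checked on generators.
-/
theorem mem_span_of_mul_pderiv_mem {i : σ} {s : Set (MvPowerSeries σ K)} (q : MvPolynomial σ K)
    (h : ∀ v ∈ s, (q : MvPowerSeries σ K) * pderiv K i v ∈ Submodule.span (MvPolynomial σ K) s)
    {v : MvPowerSeries σ K} (hv : v ∈ Submodule.span (MvPolynomial σ K) s) :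
    (q : MvPowerSeries σ K) * pderiv K i v ∈ Submodule.span (MvPolynomial σ K) s := by
  induction hv using Submodule.span_induction with
  | mem v hv => exact h v hv
  | zero => simp
  | add v w _ _ hv hw =>
    rw [map_add, mul_add]
    exact add_mem hv hw
  | smul p v hv ih =>
    have h1 : (q : MvPowerSeries σ K) * pderiv K i (p • v) =
        p • ((q : MvPowerSeries σ K) * pderiv K i v) + (q * MvPolynomial.pderiv i p) • v := by
      simp only [Algebra.smul_def, MvPowerSeries.algebraMap_apply', Derivation.leibniz,
        Algebra.algebraMap_self, MvPowerSeries.map_id, RingHom.id_apply,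
        pderiv_coe, MvPolynomial.coe_mul]
      ring
    rw [h1]
    exact add_mem (Submodule.smul_mem _ _ ih) (Submodule.smul_mem _ _ hv)

/-- If a finitely generated module over the polynomials contains `F` and is stable under
`q * ∂/∂x_i` for a nonzero polynomial `q`, then `F` satisfies a nontrivial linear differential
equation in `x_i`. -/
theorem exists_linear_ode_of_mem_span {i : σ} {F : MvPowerSeries σ K}
    {s : Set (MvPowerSeries σ K)} (hs : s.Finite) {q : MvPolynomial σ K} (hq : q ≠ 0)
    (h : ∀ v ∈ s, (q : MvPowerSeries σ K) * pderiv K i v ∈ Submodule.span (MvPolynomial σ K) s)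
    (hF : F ∈ Submodule.span (MvPolynomial σ K) s) :
    ∃ (r : ℕ) (p : ℕ → MvPolynomial σ K), p r ≠ 0 ∧
      ∑ k ∈ Finset.range (r + 1),
        (p k : MvPowerSeries σ K) * (fun G => pderiv (R := K) i G)^[k] F = 0 := by
  classical
  set E : ℕ → MvPowerSeries σ K := fun k => (fun G => pderiv (R := K) i G)^[k] F with hE
  have hE1 : ∀ k, E (k + 1) = pderiv K i (E k) := fun k => Function.iterate_succ_apply' ..
  -- Induction from `q^(k+1) ∂^(k+1) F = q ∂(q^k ∂^k F) - k (∂q) q^k ∂^k F`.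
  have hmem : ∀ k, (q ^ k) • E k ∈ Submodule.span (MvPolynomial σ K) s := by
    intro k
    induction k with
    | zero => simpa [hE] using hF
    | succ k ih =>
      have h1 := mem_span_of_mul_pderiv_mem q h ih
      have h2 : q ^ (k + 1) • E (k + 1) =
          (q : MvPowerSeries σ K) * pderiv K i (q ^ k • E k) -
            ((k : MvPolynomial σ K) * MvPolynomial.pderiv i q) • (q ^ k • E k) := by
        rw [hE1]
        simp only [Algebra.smul_def, MvPowerSeries.algebraMap_apply', Derivation.leibniz,
          Algebra.algebraMap_self, MvPowerSeries.map_id, RingHom.id_apply,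
          MvPolynomial.coe_mul, MvPolynomial.coe_pow, Derivation.leibniz_pow, pderiv_coe,
          nsmul_eq_mul]
        have h3 : ((k : MvPolynomial σ K) : MvPowerSeries σ K) = (k : MvPowerSeries σ K) :=
          map_natCast (MvPolynomial.coeToMvPowerSeries.ringHom (σ := σ) (R := K)) k
        rw [h3]
        rcases k with _ | k
        · simp
        · rw [Nat.add_sub_cancel]
          ring
      rw [h2]
      exact sub_mem h1 (Submodule.smul_mem _ _ ih)
  have := hs.fintype
  obtain ⟨N, hN⟩ : ∃ N, N = Fintype.card s := ⟨_, rfl⟩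
  -- These are `N + 1` elements in a module spanned by `N` elements over a commutative ring.
  have hdep : ¬ LinearIndependent (MvPolynomial σ K)
      (fun k : Fin (N + 1) => q ^ k.val • E k) := by
    intro hli
    have := linearIndependent_le_span_aux' _ hli s (by
      rintro _ ⟨k, rfl⟩
      exact hmem k)
    rw [Fintype.card_fin] at this
    omega
  rw [Fintype.not_linearIndependent_iff] at hdep
  obtain ⟨g, hg, k, hk⟩ := hdep
  set p : ℕ → MvPolynomial σ K := fun k => if h : k < N + 1 then g ⟨k, h⟩ * q ^ k else 0 with hp
  have hpk : p k ≠ 0 := by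
    simp only [hp, k.isLt, dif_pos]
    exact mul_ne_zero hk (pow_ne_zero _ hq)
  have hsum : ∑ k ∈ Finset.range (N + 1), (p k : MvPowerSeries σ K) * E k = 0 := by
    rw [Finset.sum_range, ← hg]
    refine Finset.sum_congr rfl fun k _ => ?_
    simp only [hp, k.isLt, dif_pos, Algebra.smul_def, MvPowerSeries.algebraMap_apply',
      Algebra.algebraMap_self, MvPowerSeries.map_id, RingHom.id_apply, MvPolynomial.coe_mul,
      MvPolynomial.coe_pow]
    ring
  -- The order `r` is the largest index with a nonzero coefficient, so that the leading coefficient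
  -- does not vanish.
  have hspec := Nat.findGreatest_spec (P := fun j => p j ≠ 0) (n := N) (by omega) hpk
  refine ⟨Nat.findGreatest (fun j => p j ≠ 0) N, p, hspec, ?_⟩
  rw [← hsum]
  refine Finset.sum_subset (fun j hj => ?_) fun j hj hj' => ?_
  · rw [Finset.mem_range] at *
    have := Nat.findGreatest_le (P := fun j => p j ≠ 0) N
    omega
  · rw [Finset.mem_range] at *
    have h0 : p j = 0 := by
      by_contra hne
      exact Nat.findGreatest_is_greatest (P := fun j => p j ≠ 0) (n := N) (k := j) (by omega)
        (by omega) hne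
    rw [h0, MvPolynomial.coe_zero, zero_mul]

theorem MvPowerSeries.coeff_X_mul [DecidableEq σ] (i : σ) (f : MvPowerSeries σ K) (d : σ →₀ ℕ) :
    coeff d (X i * f) = if d i = 0 then 0 else coeff (d - Finsupp.single i 1) f := by
  rw [X, coeff_monomial_mul, one_mul]
  by_cases h : d i = 0
  · rw [if_pos h, if_neg]
    intro hle
    have := hle i
    simp [h] at this
  · rw [if_neg h, if_pos]
    rw [Finsupp.single_le_iff]
    omega

/-- Euler operators act diagonally on monomials, so polynomial factors in a recurrence become
polynomials in these operators. -/
theorem MvPowerSeries.coeff_X_mul_pderiv (i : σ) (f : MvPowerSeries σ K) (d : σ →₀ ℕ) :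
    coeff d (X i * pderiv K i f) = d i * coeff d f := by
  classical
  rw [coeff_X_mul]
  split_ifs with h
  · simp [h]
  · have hle : Finsupp.single i 1 ≤ d := by
      rw [Finsupp.single_le_iff]
      omega
    rw [coeff_pderiv, tsub_add_cancel_of_le hle, Finsupp.tsub_apply, Finsupp.single_eq_same,
      Nat.cast_sub (by omega)]
    push_cast
    ring

end DFinite

/-! ### From coefficient recurrences to differential equations. -/

section Series

open MvPowerSeries

theorem MvPolynomial.coe_mul_mem_span {σ : Type*} (s : Set (MvPowerSeries σ ℚ))
    {v : MvPowerSeries σ ℚ} (hv : v ∈ s) (p : MvPolynomial σ ℚ) :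
    (p : MvPowerSeries σ ℚ) * v ∈ Submodule.span (MvPolynomial σ ℚ) s := by
  have := Submodule.smul_mem (Submodule.span (MvPolynomial σ ℚ) s) p (Submodule.subset_span hv)
  simpa [Algebra.smul_def, MvPowerSeries.algebraMap_apply'] using this

theorem isDFinite_of_one_variable_recurrence {F : MvPowerSeries Unit ℚ}
    (hF : ∀ (d : Unit →₀ ℕ), (d () + 2 : ℚ) * (d () + 3) * coeff (d + Finsupp.single () 1) F =
      4 * (2 * d () + 1) * (2 * d () + 3) * coeff d F) : IsDFinite F := by
  rintro ⟨⟩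
  set t : MvPowerSeries Unit ℚ := X () with ht
  set F1 := t * pderiv ℚ () F with hF1
  set F2 := t * pderiv ℚ () F1 with hF2
  set F3 := t * pderiv ℚ () F2 with hF3
  -- With `θ = t d/dt`, this is `θ(θ+1)(θ+2)F = 4t(θ+1)(2θ+1)(2θ+3)F`, the recurrence multiplied by
  -- `d + 1`; the extra factor makes the constant terms agree.
  have hrel : F3 + 3 * F2 + 2 * F1 = t * (16 * F3 + 48 * F2 + 44 * F1 + 12 * F) := by
    refine MvPowerSeries.ext fun d => ?_
    have c : ∀ (k : ℕ) (f : MvPowerSeries Unit ℚ) (d : Unit →₀ ℕ),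
        coeff d ((k : MvPowerSeries Unit ℚ) * f) = k * coeff d f := fun k f d => by
      rw [← nsmul_eq_mul, map_nsmul, nsmul_eq_mul]
    have c3 := c 3
    have c2 := c 2
    have c16 := c 16
    have c48 := c 48
    have c44 := c 44
    have c12 := c 12
    push_cast at c3 c2 c16 c48 c44 c12
    rw [coeff_X_mul]
    simp only [map_add, c3, c2, c16, c48, c44, c12, hF3, hF2, hF1, coeff_X_mul_pderiv, ht]
    split_ifs with h
    · simp [h]
    · obtain ⟨e, rfl⟩ : ∃ e, d = e + Finsupp.single () 1 :=
        ⟨d - Finsupp.single () 1, (tsub_add_cancel_of_le (by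
          rw [Finsupp.single_le_iff]; omega)).symm⟩
      rw [add_tsub_cancel_right, Finsupp.add_apply, Finsupp.single_eq_same]
      push_cast
      linear_combination ((e () : ℚ) + 1) * hF e
  -- The factor `t` of `q` turns `d/dt` into `θ`, and `1 - 16t` is the coefficient of `F3` in
  -- `hrel`.
  refine exists_linear_ode_of_mem_span (s := {F, F1, F2}) (by simp)
    (q := MvPolynomial.X () * (1 - 16 * MvPolynomial.X ())) ?_ ?_ (Submodule.subset_span (by simp))
  · refine mul_ne_zero (MvPolynomial.X_ne_zero _) fun h => ?_
    simpa using congrArg (MvPolynomial.eval 0) h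
  · have hmem : ∀ p0 p1 p2 : MvPolynomial Unit ℚ,
        (p0 : MvPowerSeries Unit ℚ) * F + (p1 : MvPowerSeries Unit ℚ) * F1 +
          (p2 : MvPowerSeries Unit ℚ) * F2 ∈
        Submodule.span (MvPolynomial Unit ℚ) {F, F1, F2} := fun p0 p1 p2 =>
      add_mem (add_mem (MvPolynomial.coe_mul_mem_span _ (by simp) _)
        (MvPolynomial.coe_mul_mem_span _ (by simp) _))
        (MvPolynomial.coe_mul_mem_span _ (by simp) _)
    have cn : ∀ k : ℕ, ((k : MvPolynomial Unit ℚ) : MvPowerSeries Unit ℚ) = k := fun k =>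
      map_natCast (MvPolynomial.coeToMvPowerSeries.ringHom (σ := Unit) (R := ℚ)) k
    have hsub : ∀ p q : MvPolynomial Unit ℚ, ((p - q : MvPolynomial Unit ℚ) : MvPowerSeries Unit ℚ)
        = p - q := fun p q =>
      map_sub (MvPolynomial.coeToMvPowerSeries.ringHom (σ := Unit) (R := ℚ)) p q
    have c16 := cn 16
    have c48 := cn 48
    have c44 := cn 44
    have c12 := cn 12
    have c2 := cn 2
    have c3 := cn 3
    push_cast at c16 c48 c44 c12 c2 c3
    rintro v (rfl | rfl | rfl)
    · convert hmem 0 (1 - 16 * MvPolynomial.X ()) 0 using 1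
      simp only [MvPolynomial.coe_mul, hsub, c16, MvPolynomial.coe_X, MvPolynomial.coe_one,
        MvPolynomial.coe_zero, hF1, ht]
      ring
    · convert hmem 0 0 (1 - 16 * MvPolynomial.X ()) using 1
      simp only [MvPolynomial.coe_mul, hsub, c16, MvPolynomial.coe_X, MvPolynomial.coe_one,
        MvPolynomial.coe_zero, hF2, ht]
      ring
    · convert hmem (12 * MvPolynomial.X ()) (44 * MvPolynomial.X () - 2)
        (48 * MvPolynomial.X () - 3) using 1
      simp only [MvPolynomial.coe_mul, hsub, c16, c2, c3, c12, c44, c48, MvPolynomial.coe_X,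
        MvPolynomial.coe_one, ← ht]
      linear_combination (1 - 16 * t) * hF3.symm + hrel

/-- Let `θ` and `η` be the Euler operators of `w = X i` and `z = X j`, and `G =
(2(θ+η)+2)(2(θ+η)+1)F`. The recurrences read `θ(θ+1)F = wG` and `η(η+1)F = zG`, so second
derivatives reduce to `F`, `θF`, `ηF` and `G`. Differentiating these relations gives a linear system
for `θG` and `ηG`, which closes the module. -/
theorem exists_linear_ode_of_two_variable_recurrence {i j : Fin 2} (hij : j ≠ i)
    {F : MvPowerSeries (Fin 2) ℚ}
    (hi : ∀ d, (d i + 1 : ℚ) * (d i + 2) * coeff (d + Finsupp.single i 1) F =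
      (2 * (d i + d j) + 2) * (2 * (d i + d j) + 1) * coeff d F)
    (hj : ∀ d, (d j + 1 : ℚ) * (d j + 2) * coeff (d + Finsupp.single j 1) F =
      (2 * (d i + d j) + 2) * (2 * (d i + d j) + 1) * coeff d F) :
    ∃ (r : ℕ) (p : ℕ → MvPolynomial (Fin 2) ℚ), p r ≠ 0 ∧
      ∑ k ∈ Finset.range (r + 1),
        (p k : MvPowerSeries (Fin 2) ℚ) * (fun G => pderiv (R := ℚ) i G)^[k] F = 0 := by
  set w : MvPowerSeries (Fin 2) ℚ := X i with hw
  set z : MvPowerSeries (Fin 2) ℚ := X j with hz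
  set A := w * pderiv ℚ i F with hA
  set B := z * pderiv ℚ j F with hB
  set P := w * pderiv ℚ i B with hP
  set AA := w * pderiv ℚ i A with hAA
  set BB := z * pderiv ℚ j B with hBB
  set G := 4 * (AA + 2 * P + BB) + 6 * (A + B) + 2 * F with hG
  have c : ∀ (k : ℕ) (f : MvPowerSeries (Fin 2) ℚ) (d : Fin 2 →₀ ℕ),
      coeff d ((k : MvPowerSeries (Fin 2) ℚ) * f) = k * coeff d f := fun k f d => by
    rw [← nsmul_eq_mul, map_nsmul, nsmul_eq_mul]
  have c4 := c 4
  have c2 := c 2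
  have c6 := c 6
  push_cast at c4 c2 c6
  have hcG : ∀ d, coeff d G = (2 * (d i + d j) + 2) * (2 * (d i + d j) + 1) * coeff d F := by
    intro d
    simp only [hG, map_add, c4, c2, c6, hAA, hA, hBB, hB, hP, hw, hz, coeff_X_mul_pderiv]
    ring
  have hPP : P = z * pderiv ℚ j A := by
    ext d
    simp only [hP, hA, hB, hw, hz, coeff_X_mul_pderiv]
    ring
  have hAA' : AA + A = w * G := by
    ext d
    rw [hw, coeff_X_mul, map_add, hAA, hA, hw, coeff_X_mul_pderiv, coeff_X_mul_pderiv]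
    split_ifs with h
    · simp [h]
    · obtain ⟨e, rfl⟩ : ∃ e, d = e + Finsupp.single i 1 :=
        ⟨d - Finsupp.single i 1, (tsub_add_cancel_of_le (by
          rw [Finsupp.single_le_iff]; omega)).symm⟩
      rw [add_tsub_cancel_right, Finsupp.add_apply, Finsupp.single_eq_same, hcG]
      push_cast
      linear_combination hi e
  have hBB' : BB + B = z * G := by
    ext d
    rw [hz, coeff_X_mul, map_add, hBB, hB, hz, coeff_X_mul_pderiv, coeff_X_mul_pderiv]
    split_ifs with h
    · simp [h]
    · obtain ⟨e, rfl⟩ : ∃ e, d = e + Finsupp.single j 1 :=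
        ⟨d - Finsupp.single j 1, (tsub_add_cancel_of_le (by
          rw [Finsupp.single_le_iff]; omega)).symm⟩
      rw [add_tsub_cancel_right, Finsupp.add_apply, Finsupp.single_eq_same, hcG]
      push_cast
      linear_combination hj e
  have hGG : (1 - 4 * (w + z)) * G = 8 * P + 2 * A + 2 * B + 2 * F := by
    linear_combination hG + 4 * hAA' + 4 * hBB'
  have two : ∀ k : Fin 2, pderiv ℚ k (2 : MvPowerSeries (Fin 2) ℚ) = 0 := fun k => by
    have := (pderiv ℚ k).map_natCast (A := MvPowerSeries (Fin 2) ℚ) 2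
    simpa using this
  have four : ∀ k : Fin 2, pderiv ℚ k (4 : MvPowerSeries (Fin 2) ℚ) = 0 := fun k => by
    have := (pderiv ℚ k).map_natCast (A := MvPowerSeries (Fin 2) ℚ) 4
    simpa using this
  have eight : ∀ k : Fin 2, pderiv ℚ k (8 : MvPowerSeries (Fin 2) ℚ) = 0 := fun k => by
    have := (pderiv ℚ k).map_natCast (A := MvPowerSeries (Fin 2) ℚ) 8
    simpa using this
  have dw : pderiv ℚ i w = 1 := pderiv_X_self
  have dz : pderiv ℚ j z = 1 := pderiv_X_self
  have dzw : pderiv ℚ j w = 0 := pderiv_X_of_ne hij.symm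
  have dwz : pderiv ℚ i z = 0 := pderiv_X_of_ne hij
  have hAP : w * pderiv ℚ i P = w * (z * pderiv ℚ j G) - P := by
    have h1 := congrArg (pderiv ℚ j) hAA'
    have h2 : w * pderiv ℚ i P = z * pderiv ℚ j AA := by
      rw [hPP]
      ext d
      simp only [hAA, hA, hw, hz, coeff_X_mul_pderiv]
      ring
    simp only [map_add, Derivation.leibniz, smul_eq_mul, dzw] at h1
    rw [h2]
    linear_combination z * h1 + hPP
  have hBP : z * pderiv ℚ j P = z * (w * pderiv ℚ i G) - P := by
    have h1 := congrArg (pderiv ℚ i) hBB'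
    have h2 : z * pderiv ℚ j P = w * pderiv ℚ i BB := by
      ext d
      simp only [hP, hBB, hB, hw, hz, coeff_X_mul_pderiv]
      ring
    simp only [map_add, Derivation.leibniz, smul_eq_mul, dwz] at h1
    rw [h2]
    linear_combination w * h1 + hP
  have hGi : (1 - 4 * (w + z)) * (w * pderiv ℚ i G) - 8 * w * (z * pderiv ℚ j G) =
      6 * w * G - 6 * P := by
    have h1 := congrArg (pderiv ℚ i) hGG
    simp only [map_add, map_sub, Derivation.leibniz, smul_eq_mul, dwz, dw, two, four, eight,
      Derivation.map_one_eq_zero] at h1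
    linear_combination w * h1 + 8 * hAP - 2 * hAA + 2 * hAA' - 2 * hA - 2 * hP
  have hGj : (1 - 4 * (w + z)) * (z * pderiv ℚ j G) - 8 * z * (w * pderiv ℚ i G) =
      6 * z * G - 6 * P := by
    have h1 := congrArg (pderiv ℚ j) hGG
    simp only [map_add, map_sub, Derivation.leibniz, smul_eq_mul, dzw, dz, two, four, eight,
      Derivation.map_one_eq_zero] at h1
    linear_combination z * h1 + 8 * hBP - 2 * hBB + 2 * hBB' - 2 * hB - 2 * hPP
  let W : MvPolynomial (Fin 2) ℚ := MvPolynomial.X i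
  let Z : MvPolynomial (Fin 2) ℚ := MvPolynomial.X j
  let R := MvPolynomial.coeToMvPowerSeries.ringHom (σ := Fin 2) (R := ℚ)
  have hRW : R W = w := MvPolynomial.coe_X _
  have hRZ : R Z = z := MvPolynomial.coe_X _
  -- In `q`, the factor `W` turns `∂/∂w` into `θ`, the `8` clears the coefficient of `P` in `hGG`,
  -- and the last factor is the determinant of the system `hGi`, `hGj`.
  refine exists_linear_ode_of_mem_span (s := {F, A, B, G}) (by simp)
    (q := 8 * W * ((1 - 4 * (W + Z)) ^ 2 - 64 * W * Z)) ?_ ?_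
    (Submodule.subset_span (by simp))
  · refine mul_ne_zero (mul_ne_zero (by norm_num) (MvPolynomial.X_ne_zero _)) fun h => ?_
    simpa [W, Z] using congrArg (MvPolynomial.eval 0) h
  · have hmem : ∀ p0 p1 p2 p3 : MvPolynomial (Fin 2) ℚ,
        R p0 * F + R p1 * A + R p2 * B + R p3 * G ∈
        Submodule.span (MvPolynomial (Fin 2) ℚ) {F, A, B, G} := fun p0 p1 p2 p3 =>
      add_mem (add_mem (add_mem (MvPolynomial.coe_mul_mem_span _ (by simp) _)
        (MvPolynomial.coe_mul_mem_span _ (by simp) _))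
        (MvPolynomial.coe_mul_mem_span _ (by simp) _))
        (MvPolynomial.coe_mul_mem_span _ (by simp) _)
    intro v hv
    change R (8 * W * ((1 - 4 * (W + Z)) ^ 2 - 64 * W * Z)) * pderiv ℚ i v ∈ _
    rcases hv with rfl | rfl | rfl | rfl
    · convert hmem 0 (8 * ((1 - 4 * (W + Z)) ^ 2 - 64 * W * Z)) 0 0 using 1
      simp only [map_mul, map_sub, map_add, map_pow, map_one, map_zero, map_ofNat, hRW, hRZ]
      linear_combination -(8 * ((1 - 4 * (w + z)) ^ 2 - 64 * w * z)) * hA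
    · convert hmem 0 (-(8 * ((1 - 4 * (W + Z)) ^ 2 - 64 * W * Z))) 0
        (8 * ((1 - 4 * (W + Z)) ^ 2 - 64 * W * Z) * W) using 1
      simp only [map_mul, map_sub, map_add, map_pow, map_one, map_zero, map_neg, map_ofNat, hRW,
        hRZ]
      linear_combination (8 * ((1 - 4 * (w + z)) ^ 2 - 64 * w * z)) * (hAA' - hAA)
    · convert hmem (-2 * ((1 - 4 * (W + Z)) ^ 2 - 64 * W * Z))
        (-2 * ((1 - 4 * (W + Z)) ^ 2 - 64 * W * Z)) (-2 * ((1 - 4 * (W + Z)) ^ 2 - 64 * W * Z))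
        (((1 - 4 * (W + Z)) ^ 2 - 64 * W * Z) * (1 - 4 * (W + Z))) using 1
      simp only [map_mul, map_sub, map_add, map_pow, map_one, map_neg, map_ofNat, hRW, hRZ]
      linear_combination ((1 - 4 * (w + z)) ^ 2 - 64 * w * z) * (- 8 * hP - hGG)
    -- Cramer's rule eliminates `ηG` from `hGi` and `hGj`; then `hGG` removes `P`.
    · convert hmem (6 * (2 * (1 - 4 * (W + Z)) + 16 * W)) (6 * (2 * (1 - 4 * (W + Z)) + 16 * W))
        (6 * (2 * (1 - 4 * (W + Z)) + 16 * W))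
        ((1 - 4 * (W + Z)) * (48 * W - 6 * (1 - 4 * (W + Z))) +
          8 * W * (48 * Z - 6 * (1 - 4 * (W + Z)))) using 1
      simp only [map_mul, map_sub, map_add, map_pow, map_one, map_ofNat, hRW, hRZ]
      linear_combination 8 * (1 - 4 * (w + z)) * hGi + 64 * w * hGj +
        (6 * (1 - 4 * (w + z)) + 48 * w) * hGG

end Series

/-! ### Enumeration and closed formulas. -/

open RotationSystem Equiv.Perm

namespace TreeRootedMap

theorem Iso.numVertices_eq : ∀ {X Y : TreeRootedMap}, Iso X Y → X.numVertices = Y.numVertices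
  | atomic, atomic, _ => rfl
  | ofDarts _ _ _ _ _ _ _, ofDarts _ _ _ _ _ _ _, ⟨e, hn, _, _, _⟩ => numCycles_conj _ _ e hn

theorem Iso.numEdges_eq : ∀ {X Y : TreeRootedMap}, Iso X Y → X.numEdges = Y.numEdges
  | atomic, atomic, _ => rfl
  | ofDarts _ _ _ _ _ _ _, ofDarts _ _ _ _ _ _ _, ⟨e, _, ho, _, _⟩ => numCycles_conj _ _ e ho

theorem eq_atomic_of_numEdges_eq_zero : ∀ X : TreeRootedMap, X.numEdges = 0 → X = atomic
  | atomic, _ => rfl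
  | ofDarts _ _ M _ root _ _, h => by
    have : Nonempty M.Edge := ⟨M.edge root⟩
    exact absurd h Finite.card_pos.ne'

/-- Isomorphism classes of tree-rooted maps with a given number of darts are counted by codes. -/
theorem ncard_image_eq_card_filter_tourCodes {m : ℕ} [NeZero m] {Q : TreeRootedMap → Prop}
    {p : Finset (Fin m) → Prop} [DecidablePred p] (hQ : ∀ X Y, Iso X Y → Q Y → Q X)
    (hm : ∀ X, Q X → 2 * X.numEdges = m)
    (hp : ∀ {S : Finset (Fin m)} {f g} (hc : ⟨S, f, g⟩ ∈ tourCodes m), Q (ofCode hc) ↔ p S) :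
    ((Quotient.mk isoSetoid) '' {X | Q X}).ncard = ((tourCodes m).filter fun c => p c.1).card := by
  rw [← Set.ncard_coe_finset]
  symm
  refine Set.ncard_congr (fun c hc => Quotient.mk isoSetoid
    (ofCode (S := c.1) (f := c.2.1) (g := c.2.2) (Finset.mem_filter.1 hc).1)) ?_ ?_ ?_
  · rintro ⟨S, f, g⟩ hc
    have hc' := Finset.mem_filter.1 hc
    exact ⟨_, (hp hc'.1).2 hc'.2, rfl⟩
  · rintro ⟨S, f, g⟩ ⟨S', f', g'⟩ hc hc' h
    obtain ⟨rfl, rfl, rfl⟩ := eq_of_iso_ofCode _ _ (Quotient.exact h)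
    rfl
  · rintro _ ⟨X, hX, rfl⟩
    obtain ⟨S, f, g, hc, hiso⟩ := exists_iso_ofCode X (hm X hX)
    exact ⟨⟨S, f, g⟩, Finset.mem_filter.2 ⟨hc, (hp hc).1 (hQ _ _ hiso hX)⟩, Quotient.sound hiso⟩

theorem card_filter_tourCodes {m : ℕ} (p : Finset (Fin m) → Prop) [DecidablePred p] :
    ((tourCodes m).filter fun c => p c.1).card =
      ∑ S ∈ Finset.univ.filter p, matchingNumber S.card * matchingNumber (m - S.card) := by
  have : (tourCodes m).filter (fun c => p c.1) = (Finset.univ.filter p).sigma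
      fun S => noncrossingMatchings S ×ˢ noncrossingMatchings Sᶜ := by
    ext c
    simp only [tourCodes, Finset.mem_filter, Finset.mem_sigma, Finset.mem_univ, true_and]
    tauto
  rw [this, Finset.card_sigma]
  refine Finset.sum_congr rfl fun S _ => ?_
  rw [Finset.card_product, card_noncrossingMatchings, card_noncrossingMatchings,
    Finset.card_compl, Fintype.card_fin]

theorem image_mk_atomic {Q : TreeRootedMap → Prop} (h : ∀ X, Q X ↔ X = atomic) :
    ((Quotient.mk isoSetoid) '' {X | Q X}).ncard = 1 := by
  rw [Set.ncard_eq_one]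
  exact ⟨Quotient.mk _ atomic, by simp [h]⟩

theorem countVerticesFaces_eq (i j : ℕ) : countVerticesFaces (i + 1) (j + 1) =
    (2 * i + 2 * j).choose (2 * i) * (catalan i * catalan j) := by
  -- Without edges there is no root dart and no code; only the atomic map remains.
  rcases Nat.eq_zero_or_pos (i + j) with h0 | hpos
  · obtain ⟨rfl, rfl⟩ : i = 0 ∧ j = 0 := by omega
    rw [countVerticesFaces, image_mk_atomic]
    · simp
    · intro X
      constructor
      · rintro ⟨h1, h2⟩
        refine eq_atomic_of_numEdges_eq_zero X ?_
        have := X.numVertices_add_numFaces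
        omega
      · rintro rfl
        exact ⟨rfl, rfl⟩
  · have : NeZero (2 * i + 2 * j) := ⟨by omega⟩
    rw [countVerticesFaces, ncard_image_eq_card_filter_tourCodes (m := 2 * i + 2 * j)
      (p := fun S => S.card = 2 * i), card_filter_tourCodes fun S => S.card = 2 * i]
    · rw [Finset.univ_filter_card_eq, Finset.sum_congr rfl (g := fun _ => catalan i * catalan j),
        Finset.sum_const, Finset.card_powersetCard, Finset.card_univ, Fintype.card_fin, smul_eq_mul]
      intro S hS
      rw [(Finset.mem_powersetCard.1 hS).2, Nat.add_sub_cancel_left, matchingNumber_two_mul,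
        matchingNumber_two_mul]
    · intro X Y h hY
      have h1 := h.numVertices_eq
      have h2 := h.numEdges_eq
      have h3 := X.numVertices_add_numFaces
      have h4 := Y.numVertices_add_numFaces
      omega
    · intro X hX
      have h3 := X.numVertices_add_numFaces
      omega
    · intro S f g hc
      have h1 := two_mul_numVertices_ofCode hc
      have h2 := two_mul_numEdges_ofCode hc
      have h3 := (ofCode hc).numVertices_add_numFaces
      omega

theorem countEdges_eq (n : ℕ) : countEdges n =
    ∑ i ∈ Finset.range (n + 1), (2 * n).choose (2 * i) * (catalan i * catalan (n - i)) := by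
  rcases Nat.eq_zero_or_pos n with rfl | hpos
  · rw [countEdges, image_mk_atomic]
    · simp
    · exact fun X => ⟨eq_atomic_of_numEdges_eq_zero X, by rintro rfl; rfl⟩
  · have : NeZero (2 * n) := ⟨by omega⟩
    rw [countEdges, ncard_image_eq_card_filter_tourCodes (m := 2 * n) (p := fun _ => True),
      card_filter_tourCodes fun _ => True]
    · rw [Finset.filter_true, ← Finset.powerset_univ,
        Finset.sum_powerset_apply_card (fun k => matchingNumber k * matchingNumber (2 * n - k)),
        Finset.card_univ, Fintype.card_fin, Finset.sum_range_two_mul_add_one, add_eq_left.2]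
      · refine Finset.sum_congr rfl fun i _ => ?_
        rw [← Nat.mul_sub, matchingNumber_two_mul, matchingNumber_two_mul, smul_eq_mul]
      -- A set of odd size has no perfect matching.
      · refine Finset.sum_eq_zero fun i _ => ?_
        rw [matchingNumber_odd (by simp [parity_simps]), zero_mul, smul_zero]
    · intro X Y h hY
      rw [h.numEdges_eq, hY]
    · rintro X rfl
      rfl
    · intro S f g hc
      have h2 := two_mul_numEdges_ofCode hc
      simp only [iff_true]
      omega

end TreeRootedMap

open Nat in
theorem cast_catalan (n : ℕ) : (catalan n : ℚ) = (2 * n)! / (n ! * (n + 1)!) := by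
  have h1 : ((n + 1 : ℕ) : ℚ) * catalan n = n.centralBinom := by
    exact_mod_cast succ_mul_catalan_eq_centralBinom n
  rw [Nat.centralBinom_eq_two_mul_choose, Nat.cast_choose ℚ (by omega),
    show 2 * n - n = n by omega] at h1
  have h2 : (n ! : ℚ) ≠ 0 := by exact_mod_cast n.factorial_ne_zero
  have h3 : ((n + 1 : ℕ) : ℚ) ≠ 0 := by positivity
  rw [eq_div_iff (by positivity)] at h1 ⊢
  rw [Nat.factorial_succ, ← h1]
  push_cast
  ring

open Nat in
theorem cast_choose_mul_catalan_mul_catalan (i j : ℕ) :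
    ((((2 * i + 2 * j).choose (2 * i) * (catalan i * catalan j) : ℕ)) : ℚ) =
      (2 * i + 2 * j)! / (i ! * (i + 1)! * j ! * (j + 1)!) := by
  rw [Nat.cast_mul, Nat.cast_mul, cast_catalan, cast_catalan, Nat.cast_choose ℚ (by omega),
    Nat.add_sub_cancel_left]
  have h1 : (((2 * i)! : ℕ) : ℚ) ≠ 0 := by exact_mod_cast Nat.factorial_ne_zero _
  have h2 : (((2 * j)! : ℕ) : ℚ) ≠ 0 := by exact_mod_cast Nat.factorial_ne_zero _
  field_simp

-- After extracting `(2n)! / (n+1)!²`, the terms are `(n+1).choose i * (n+1).choose (n-i)`, and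
-- Vandermonde sums them to `(2n+2).choose n`.
open Nat in
theorem sum_div_factorials (n : ℕ) :
    ∑ i ∈ Finset.range (n + 1),
      ((2 * n)! : ℚ) / (i ! * (i + 1)! * (n - i)! * (n - i + 1)!) =
      ((2 * n)! * (2 * n + 2)!) / (n ! * (n + 1)! ^ 2 * (n + 2)!) := by
  have hv := Nat.add_choose_eq (n + 1) (n + 1) n
  rw [Finset.Nat.sum_antidiagonal_eq_sum_range_succ
    (fun i j => (n + 1).choose i * (n + 1).choose j)] at hv
  have hq := congrArg (Nat.cast (R := ℚ)) hv
  rw [Nat.cast_choose ℚ (by omega), Nat.cast_sum, show n + 1 + (n + 1) - n = n + 2 by omega,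
    show n + 1 + (n + 1) = 2 * n + 2 by ring] at hq
  have h1 : ((n + 1)! : ℚ) ≠ 0 := by exact_mod_cast Nat.factorial_ne_zero _
  rw [show ((2 * n)! * (2 * n + 2)! : ℚ) / (n ! * (n + 1)! ^ 2 * (n + 2)!) =
    (2 * n)! / (n + 1)! ^ 2 * ((2 * n + 2)! / (n ! * (n + 2)!)) by field_simp, hq, Finset.mul_sum]
  refine Finset.sum_congr rfl fun i hi => ?_
  rw [Finset.mem_range] at hi
  rw [Nat.cast_mul, Nat.cast_choose ℚ (by omega), Nat.cast_choose ℚ (by omega),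
    show n + 1 - i = n - i + 1 by omega, show n + 1 - (n - i) = i + 1 by omega]
  field_simp

theorem cast_countVerticesFaces (i j : ℕ) :
    (TreeRootedMap.countVerticesFaces (i + 1) (j + 1) : ℚ) =
      ((2 * i + 2 * j).factorial : ℚ) /
        (i.factorial * (i + 1).factorial * j.factorial * (j + 1).factorial) := by
  rw [TreeRootedMap.countVerticesFaces_eq, cast_choose_mul_catalan_mul_catalan]

theorem cast_countEdges (n : ℕ) : (TreeRootedMap.countEdges n : ℚ) =
      ((2 * n).factorial * (2 * n + 2).factorial : ℚ) /
        (n.factorial * (n + 1).factorial ^ 2 * (n + 2).factorial) := by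
  rw [TreeRootedMap.countEdges_eq, ← sum_div_factorials, Nat.cast_sum]
  refine Finset.sum_congr rfl fun i hi => ?_
  rw [Finset.mem_range] at hi
  have h := cast_choose_mul_catalan_mul_catalan i (n - i)
  rwa [show 2 * i + 2 * (n - i) = 2 * n by omega] at h

open MvPowerSeries

theorem isDFinite_edgeSeries : IsDFinite (σ := Unit) (K := ℚ) TreeRootedMap.edgeSeries := by
  refine isDFinite_of_one_variable_recurrence fun d => ?_
  have hc : ∀ d : Unit →₀ ℕ, coeff d (TreeRootedMap.edgeSeries : MvPowerSeries Unit ℚ) =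
      TreeRootedMap.countEdges (d ()) := fun _ => rfl
  rw [hc, hc, Finsupp.add_apply, Finsupp.single_eq_same, cast_countEdges, cast_countEdges]
  generalize d () = n
  rw [show 2 * (n + 1) = 2 * n + 1 + 1 by ring]
  simp only [Nat.factorial_succ]
  push_cast
  have h1 : (n.factorial : ℚ) ≠ 0 := by exact_mod_cast Nat.factorial_ne_zero _
  have h2 : ((2 * n).factorial : ℚ) ≠ 0 := by exact_mod_cast Nat.factorial_ne_zero _
  have h3 : (n + 1 : ℚ) ≠ 0 := by positivity
  have h4 : (n + 1 + 1 : ℚ) ≠ 0 := by positivity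
  have h5 : (n + 1 + 1 + 1 : ℚ) ≠ 0 := by positivity
  field_simp
  ring

theorem countVerticesFaces_recurrence (i j : ℕ) :
    (i + 1 : ℚ) * (i + 2) * TreeRootedMap.countVerticesFaces (i + 1 + 1) (j + 1) =
      (2 * (i + j) + 2) * (2 * (i + j) + 1) *
        TreeRootedMap.countVerticesFaces (i + 1) (j + 1) := by
  rw [cast_countVerticesFaces, cast_countVerticesFaces,
    show 2 * (i + 1) + 2 * j = 2 * i + 2 * j + 1 + 1 by ring]
  simp only [Nat.factorial_succ]
  push_cast
  have h1 : (i.factorial : ℚ) ≠ 0 := by exact_mod_cast Nat.factorial_ne_zero _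
  have h2 : (j.factorial : ℚ) ≠ 0 := by exact_mod_cast Nat.factorial_ne_zero _
  have h3 : (i + 1 : ℚ) ≠ 0 := by positivity
  have h4 : (i + 1 + 1 : ℚ) ≠ 0 := by positivity
  have h5 : (j + 1 : ℚ) ≠ 0 := by positivity
  field_simp
  ring

/-- This reflects map duality, but is read off the formula; it transfers the recurrence to the
second index. -/
theorem countVerticesFaces_comm (i j : ℕ) :
    TreeRootedMap.countVerticesFaces (i + 1) (j + 1) =
      TreeRootedMap.countVerticesFaces (j + 1) (i + 1) := by
  have : (TreeRootedMap.countVerticesFaces (i + 1) (j + 1) : ℚ) =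
      TreeRootedMap.countVerticesFaces (j + 1) (i + 1) := by
    rw [cast_countVerticesFaces, cast_countVerticesFaces, add_comm (2 * i)]
    ring
  exact_mod_cast this

theorem isDFinite_vertexFaceSeries : IsDFinite TreeRootedMap.vertexFaceSeries := by
  have hc : ∀ d : Fin 2 →₀ ℕ, coeff d TreeRootedMap.vertexFaceSeries =
      (TreeRootedMap.countVerticesFaces (d 0 + 1) (d 1 + 1) : ℚ) := fun _ => rfl
  have h0 : ∀ d : Fin 2 →₀ ℕ, (d 0 + 1 : ℚ) * (d 0 + 2) *
      coeff (d + Finsupp.single 0 1) TreeRootedMap.vertexFaceSeries =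
      (2 * (d 0 + d 1) + 2) * (2 * (d 0 + d 1) + 1) *
        coeff d TreeRootedMap.vertexFaceSeries := by
    intro d
    rw [hc, hc]
    simpa using countVerticesFaces_recurrence (d 0) (d 1)
  have h1 : ∀ d : Fin 2 →₀ ℕ, (d 1 + 1 : ℚ) * (d 1 + 2) *
      coeff (d + Finsupp.single 1 1) TreeRootedMap.vertexFaceSeries =
      (2 * (d 0 + d 1) + 2) * (2 * (d 0 + d 1) + 1) *
        coeff d TreeRootedMap.vertexFaceSeries := by
    intro d
    rw [hc, hc, countVerticesFaces_comm, countVerticesFaces_comm (d 0)]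
    simpa [add_comm (d 1 : ℚ)] using countVerticesFaces_recurrence (d 1) (d 0)
  refine Fin.forall_fin_two.2 ⟨?_, ?_⟩
  · exact exists_linear_ode_of_two_variable_recurrence (by decide : (1 : Fin 2) ≠ 0) h0 h1
  · refine exists_linear_ode_of_two_variable_recurrence (by decide : (0 : Fin 2) ≠ 1) ?_ ?_
    · simpa only [add_comm] using h1
    · simpa only [add_comm] using h0

theorem mainTheorem9 :
    (∀ n : ℕ, (TreeRootedMap.countEdges n : ℚ) =
      ((2 * n).factorial * (2 * n + 2).factorial : ℚ) /
        (n.factorial * (n + 1).factorial ^ 2 * (n + 2).factorial)) ∧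
    (∀ i j : ℕ, (TreeRootedMap.countVerticesFaces (i + 1) (j + 1) : ℚ) =
      ((2 * i + 2 * j).factorial : ℚ) /
        (i.factorial * (i + 1).factorial * j.factorial * (j + 1).factorial)) ∧
    IsDFinite (σ := Unit) (K := ℚ) TreeRootedMap.edgeSeries ∧
    IsDFinite TreeRootedMap.vertexFaceSeries :=
  ⟨cast_countEdges, cast_countVerticesFaces, isDFinite_edgeSeries, isDFinite_vertexFaceSeries⟩
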